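/- Let $m,n\ge 1$ and let $\lambda\subseteq\nu$ be (possibly empty) partitions contained in the rectangle $(n-1)^{m-1}$. For a partition $\mu=(\mu_1\ge\mu_2\ge\cdots)$ with $\lambda\subseteq\mu\subseteq\nu$ let $M^\mu$ be the $m\times n$ matrix with $M^\mu_{1,\mu_1+1}=1$; with $M^\mu_{k+1,\mu_{k+1}+1}=1$ and $M^\mu_{k+1,\mu_k+1}=-1$ whenever $1\le k\le m-1$ and $\mu_k>\mu_{k+1}$; and with all other entries $0$. Let $\mathrm{PASM}(\nu/\lambda)=\mathrm{PASM}(\nu/\lambda,m,n)\subset\mathbb R^{mn}$ be the convex hull of the matrices $M^\mu$, $\lambda\subseteq\mu\subseteq\nu$. Let $P=P(\nu/\lambda)$ be the poset of boxes $(i,j)$ of $\nu$ not in $\lambda$, ordered componentwise, and let $\widehat P$ be $P$ with a new minimum $\widehat 0$ and a new maximum $\widehat 1$ adjoined. A poset $P$ is strongly planar if the Hasse diagram of $\widehat P$ (each covering pair $p\lessdot q$ being drawn as a curve going upwards from $p$ to $q$) has an embedding in the plane without crossings, with larger elements at larger height. Let $H$ be the plane graph obtained from such a drawing by adding two further (upward)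 edges from $\widehat 0$ to $\widehat 1$, one to the left and one to the right of everything else. Let $G_P$ be the truncated dual of $H$, i.e. the dual graph of $H$ with the vertex of the infinite face deleted: its vertices are the bounded faces of $H$, its edges are dual to the edges of the Hasse diagram of $\widehat P$, and the edge dual to $p\lessdot q$ is directed from the face on the left of the curve from $p$ to $q$ to the face on its right (so that $q$ lies on the left and $p$ on the right when the dual edge is traversed). For a connected graph $G$ on $[k]=\{1,\dots,k\}$ with edges directed from the smaller to the larger vertex, the flow polytope $\mathcal F_G\subset\mathbb R^{E(G)}$ is the set of functions $fl:E(G)\to\mathbb R_{\ge0}$ such that the total flow on the edges leaving vertex $1$ is $1$, the total flow on the edges entering vertex $k$ is $1$, and at each other vertex the total incoming flow equals the total outgoing flow. Sets $\mathcal P\subset\mathbb R^d$ and $\mathcal Q\subset\mathbb R^r$ are integrally equivalent if some affine map $\mathbb R^d\to\mathbb R^r$ maps $\mathcal P$ bijectively onto $\mathcal Q$ and $\mathbb Z^d\cap\mathrm{aff}(\mathcal P)$ bijectively onto $\mathbb Z^r\cap\mathrm{aff}(\mathcal Q)$. Then the poset $P(\nu/\lambda)$ is strongly planar, and a plane graph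 $H$ as above exists. For every such $H$, the graph $G=G_{P(\nu/\lambda)}$ is connected and its vertices can be numbered $1,\dots,k$ so that all edges are directed from the smaller to the larger vertex; and for every such numbering $\mathrm{PASM}(\nu/\lambda)$ is integrally equivalent to the flow polytope $\mathcal F_{G}$. -/

import Mathlib

open Set Filter Topology

noncomputable section

/-! ### Integral equivalence -/

/-- The lattice `ℤ^ι` inside `ℝ^ι`. -/
def integerPoints (ι : Type*) : Set (ι → ℝ) :=
  {x | ∀ i, ∃ z : ℤ, x i = z}

/-- `P ⊆ ℝ^ι` and `Q ⊆ ℝ^κ` are integrally equivalent: some affine map `ℝ^ι → ℝ^κ` maps `P`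
bijectively onto `Q` and `ℤ^ι ∩ aff P` bijectively onto `ℤ^κ ∩ aff Q`. -/
def IntegrallyEquivalent {ι κ : Type*} (P : Set (ι → ℝ)) (Q : Set (κ → ℝ)) : Prop :=
  ∃ f : (ι → ℝ) →ᵃ[ℝ] (κ → ℝ),
    BijOn f P Q ∧
    BijOn f (integerPoints ι ∩ (affineSpan ℝ P : Set (ι → ℝ)))
      (integerPoints κ ∩ (affineSpan ℝ Q : Set (κ → ℝ)))

/-! ### The partial alternating sign matrix polytope of a skew shape

A partition is a Young diagram `μ`. Indices start at `0`: `μ.rowLen i` is the part `μ_{i+1}`, and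
the box in row `i + 1` and column `j + 1` is the pair `(i, j)`. -/

/-- Entries of the matrix `M^μ` (rows and columns counted from `0`). The first row has a single `1`,
in column `μ_1 + 1` (counted from `1`). If `μ_k > μ_{k+1}`, then row `k + 1` has a `1` in column
`μ_{k+1} + 1` and a `-1` in column `μ_k + 1`. All other entries vanish. -/
def partitionMatrixEntry (μ : YoungDiagram) : ℕ → ℕ → ℤ
  | 0, j => if j = μ.rowLen 0 then 1 else 0
  | k + 1, j =>
    if μ.rowLen (k + 1) < μ.rowLen k then
      if j = μ.rowLen (k + 1) then 1 else if j = μ.rowLen k then -1 else 0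
    else 0

/-- The `m × n` matrix `M^μ(m, n)`. -/
def partitionMatrix (μ : YoungDiagram) (m n : ℕ) : Matrix (Fin m) (Fin n) ℤ :=
  Matrix.of fun i j => partitionMatrixEntry μ i j

/-- `PASM(ν/λ, m, n)`: the convex hull in `ℝ^{mn}` of the matrices `M^μ(m, n)`, `λ ⊆ μ ⊆ ν`. -/
def pasmPolytope (nu lam : YoungDiagram) (m n : ℕ) : Set (Fin m × Fin n → ℝ) :=
  convexHull ℝ
    {v | ∃ μ : YoungDiagram, lam ≤ μ ∧ μ ≤ nu ∧
      v = fun c => (partitionMatrix μ m n c.1 c.2 : ℝ)}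

/-- The poset `P(ν/λ)`: the boxes of `ν` that are not in `λ`, ordered componentwise. -/
abbrev SkewPoset (nu lam : YoungDiagram) : Type :=
  {c : ℕ × ℕ // c ∈ nu ∧ c ∉ lam}

instance instFiniteSkewPoset (nu lam : YoungDiagram) : Finite (SkewPoset nu lam) :=
  Set.Finite.to_subtype (nu.cells.finite_toSet.subset fun _ hc => hc.1)

/-! ### Strongly planar posets -/

/-- `P` with a new minimum `⊥` and a new maximum `⊤` adjoined. -/
abbrev PosetHat (P : Type*) : Type _ := WithBot (WithTop P)

/-- The edges of the Hasse diagram of `PosetHat P`: the covering pairs `p ⋖ q`. -/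
abbrev HasseEdge (P : Type*) [PartialOrder P] : Type _ :=
  {e : PosetHat P × PosetHat P // e.1 ⋖ e.2}

instance instFiniteHasseEdge (P : Type*) [PartialOrder P] [Finite P] : Finite (HasseEdge P) :=
  haveI : Finite (PosetHat P) := inferInstanceAs (Finite (Option (Option P)))
  inferInstance

instance instFintypeHasseEdge (P : Type*) [PartialOrder P] [Finite P] : Fintype (HasseEdge P) :=
  Fintype.ofFinite _

/-- A planar embedding of the Hasse diagram of `PosetHat P` in which larger elements lie higher.
As usual for Hasse diagrams, the edge `p ⋖ q` is a curve going upwards from `p` to `q`; so it is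
given by its horizontal coordinate as a function of the height in `[height p, height q]`
(the values of the function outside this interval play no role). -/
structure HasseDrawing (P : Type*) [PartialOrder P] where
  /-- the position of a vertex, horizontal coordinate first -/
  pos : PosetHat P → ℝ × ℝ
  pos_injective : Function.Injective pos
  height_strictMono : StrictMono fun p => (pos p).2
  curve : HasseEdge P → ℝ → ℝ
  curve_continuousOn : ∀ e : HasseEdge P,
    ContinuousOn (curve e) (Icc (pos e.1.1).2 (pos e.1.2).2)
  curve_lower : ∀ e : HasseEdge P, curve e (pos e.1.1).2 = (pos e.1.1).1
  curve_upper : ∀ e : HasseEdge P, curve e (pos e.1.2).2 = (pos e.1.2).1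
  /-- an edge passes through no vertices but its two ends -/
  vertex_on_curve : ∀ (e : HasseEdge P) (v : PosetHat P),
    (pos v).2 ∈ Icc (pos e.1.1).2 (pos e.1.2).2 → curve e (pos v).2 = (pos v).1 →
      v = e.1.1 ∨ v = e.1.2
  /-- two different edges meet only in vertices (hence only in common ends) -/
  curve_inter : ∀ (e e' : HasseEdge P) (y : ℝ), e ≠ e' →
    y ∈ Icc (pos e.1.1).2 (pos e.1.2).2 → y ∈ Icc (pos e'.1.1).2 (pos e'.1.2).2 →
      curve e y = curve e' y → ∃ v : PosetHat P, pos v = (curve e y, y)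

/-- A poset `P` is strongly planar if the Hasse diagram of `PosetHat P` has such an embedding. -/
def StronglyPlanar (P : Type*) [PartialOrder P] : Prop :=
  Nonempty (HasseDrawing P)

/-- A planar embedding of the augmented Hasse diagram `H`: the Hasse diagram of `PosetHat P` with two
additional edges from `⊥` to `⊤`, one to the left and one to the right of everything else. -/
structure AugmentedDrawing (P : Type*) [PartialOrder P] extends HasseDrawing P where
  leftCurve : ℝ → ℝ
  rightCurve : ℝ → ℝ
  left_continuousOn : ContinuousOn leftCurve (Icc (pos ⊥).2 (pos ⊤).2)
  right_continuousOn : ContinuousOn rightCurve (Icc (pos ⊥).2 (pos ⊤).2)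
  left_bot : leftCurve (pos ⊥).2 = (pos ⊥).1
  left_top : leftCurve (pos ⊤).2 = (pos ⊤).1
  right_bot : rightCurve (pos ⊥).2 = (pos ⊥).1
  right_top : rightCurve (pos ⊤).2 = (pos ⊤).1
  left_lt : ∀ y ∈ Ioo (pos ⊥).2 (pos ⊤).2, ∀ e : HasseEdge P,
    y ∈ Icc (pos e.1.1).2 (pos e.1.2).2 → leftCurve y < curve e y
  lt_right : ∀ y ∈ Ioo (pos ⊥).2 (pos ⊤).2, ∀ e : HasseEdge P,
    y ∈ Icc (pos e.1.1).2 (pos e.1.2).2 → curve e y < rightCurve y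

/-! ### The truncated dual -/

namespace AugmentedDrawing

variable {P : Type*} [PartialOrder P]

/-- The subset of the plane covered by the drawing of `H` (every vertex is the end of an edge). -/
def support (D : AugmentedDrawing P) : Set (ℝ × ℝ) :=
  {z | ∃ e : HasseEdge P, z.2 ∈ Icc (D.pos e.1.1).2 (D.pos e.1.2).2 ∧ z.1 = D.curve e z.2} ∪
  {z | z.2 ∈ Icc (D.pos ⊥).2 (D.pos ⊤).2 ∧ (z.1 = D.leftCurve z.2 ∨ z.1 = D.rightCurve z.2)}

/-- The faces of `H`: the connected components of the complement of the drawing. -/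
def IsFace (D : AugmentedDrawing P) (F : Set (ℝ × ℝ)) : Prop :=
  ∃ z ∈ D.supportᶜ, F = connectedComponentIn D.supportᶜ z

/-- The faces of `H` other than the infinite one. -/
def BoundedFace (D : AugmentedDrawing P) : Type :=
  {F : Set (ℝ × ℝ) // D.IsFace F ∧ Bornology.IsBounded F}

/-- The face `F` lies along the edge `e`, on its left. -/
def IsLeftFace (D : AugmentedDrawing P) (F : Set (ℝ × ℝ)) (e : HasseEdge P) : Prop :=
  ∀ y ∈ Ioo (D.pos e.1.1).2 (D.pos e.1.2).2, ∀ᶠ x in 𝓝[<] (D.curve e y), (x, y) ∈ F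

/-- The face `F` lies along the edge `e`, on its right. -/
def IsRightFace (D : AugmentedDrawing P) (F : Set (ℝ × ℝ)) (e : HasseEdge P) : Prop :=
  ∀ y ∈ Ioo (D.pos e.1.1).2 (D.pos e.1.2).2, ∀ᶠ x in 𝓝[>] (D.curve e y), (x, y) ∈ F

end AugmentedDrawing

/-- A connected (multi)graph on the vertex set `Fin k` (the vertices `1, …, k` counted from `0`) with
edge set `E`; the edges are directed from the smaller to the larger vertex. -/
structure OrderedGraph (k : ℕ) (E : Type*) where
  tail : E → Fin k
  head : E → Fin k
  tail_lt_head : ∀ e, tail e < head e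
  connected : (SimpleGraph.fromRel fun u v => ∃ e, tail e = u ∧ head e = v).Connected

/-- `G` is the graph `G_P` obtained from the drawing `D`: the truncated dual of `H`. Its vertices,
numbered `1, …, k` in an order compatible with the orientation, are the bounded faces of `H`. Its
edges are dual to the edges of the Hasse diagram of `PosetHat P`; the duals of the two additional
edges of `H` are incident with the infinite face and are deleted together with it. The edge dual to
`p ⋖ q` has the upper vertex `q` on its left and the lower vertex `p` on its right; so it leads from
the face on the left of the curve from `p` up to `q` to the face on the right of it. -/
def IsTruncatedDual {P : Type*} [PartialOrder P] (D : AugmentedDrawing P) {k : ℕ}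
    (G : OrderedGraph k (HasseEdge P)) : Prop :=
  ∃ φ : Fin k ≃ D.BoundedFace, ∀ e : HasseEdge P,
    D.IsLeftFace (φ (G.tail e)).1 e ∧ D.IsRightFace (φ (G.head e)).1 e

/-! ### Flow polytopes -/

/-- The flow polytope of `G`: the flows of size one from the first vertex to the last one. -/
def flowPolytope {k : ℕ} {E : Type*} [Fintype E] (G : OrderedGraph k E) : Set (E → ℝ) :=
  {fl | (∀ e, 0 ≤ fl e) ∧
    ∑ e with (G.tail e : ℕ) = 0, fl e = 1 ∧
    ∑ e with (G.head e : ℕ) + 1 = k, fl e = 1 ∧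
    ∀ v : Fin k, 0 < (v : ℕ) → (v : ℕ) + 1 < k →
      ∑ e with G.head e = v, fl e = ∑ e with G.tail e = v, fl e}

end

/-!
A function on the faces of `H` jumps across each edge, and the jumps of the edges that cross a
horizontal line telescope. If the function is extended by `0` to the unbounded face, its jumps are
therefore conserved at every vertex of `H` other than `⊥` and `⊤`. Summation by parts turns this
into `∑ (f q - f p) (g (right p q) - g (left p q)) = (f ⊤ - f ⊥) (g sink - g source)`, the sum being
over the edges `p ⋖ q`, for every `f` on the vertices and every `g` on the bounded faces. So the
differences `f q - f p` of an order-preserving `f` with `f ⊥ = 0` and `f ⊤ = 1` are a unit flow on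
the truncated dual. Conversely, taking for `g` the side of a maximal chain on which a face lies, one
sees that every unit flow sums to `1` along every maximal chain, and hence is such a difference.
Thus the flow polytope is integrally equivalent to the order polytope of the augmented poset.

On the other side, the corner sum of `M^μ` at a box is `0` if the box belongs to `μ`, and `1`
otherwise. So the corner sums map the vertices of `PASM(ν/λ)` to the order-preserving functions with
values `0` and `1`, which are the vertices of the order polytope.

The Hasse diagram of a skew shape is drawn by rotating the shape: the box `(i, j)` has the
horizontal coordinate `j - i` and the height `i + j`. The edges from `⊥` and to `⊤` are vertical at
first; multiplying all horizontal coordinates by a factor which is `1` on the heights of the boxes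
then contracts the picture to one point at the bottom and one at the top.
-/

noncomputable section

/-! ### Families of curves in the plane -/

/-- A family of curves in the plane, each the graph of a horizontal coordinate over an interval
`[lo i, hi i]` of heights, such that the interior of each curve is disjoint from all other curves.
The horizontal coordinates are continuous functions on all of `ℝ`; their values outside
`[lo i, hi i]` play no role. -/
structure CurveSystem (ι : Type*) where
  lo : ι → ℝ
  hi : ι → ℝ
  lo_lt_hi : ∀ i, lo i < hi i
  curve : ι → ℝ → ℝ
  continuous_curve : ∀ i, Continuous (curve i)
  curve_ne : ∀ i j y, i ≠ j → y ∈ Ioo (lo i) (hi i) → y ∈ Icc (lo j) (hi j) →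
    curve i y ≠ curve j y

namespace CurveSystem

variable {ι : Type*} (C : CurveSystem ι)

/-- The set of points on a curve. -/
def trace (i : ι) : Set (ℝ × ℝ) := {z | z.2 ∈ Icc (C.lo i) (C.hi i) ∧ z.1 = C.curve i z.2}

/-- The set of points on the curves of a system. -/
def support : Set (ℝ × ℝ) := {z | ∃ i, z ∈ C.trace i}

/-- The component of a point in the complement of the curves. -/
def component (z : ℝ × ℝ) : Set (ℝ × ℝ) := connectedComponentIn C.supportᶜ z

lemma isClosed_trace (i : ι) : IsClosed (C.trace i) :=
  (isClosed_Icc.preimage continuous_snd).inter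
    (isClosed_eq continuous_fst ((C.continuous_curve i).comp continuous_snd))

lemma isClosed_setOf_exists_mem_trace [Finite ι] (p : ι → Prop) :
    IsClosed {z | ∃ i, p i ∧ z ∈ C.trace i} := by
  have heq : {z | ∃ i, p i ∧ z ∈ C.trace i} = ⋃ i ∈ {i | p i}, C.trace i := by
    ext z; simp
  rw [heq]
  exact (Set.toFinite _).isClosed_biUnion fun i _ => C.isClosed_trace i

lemma component_eq_of_mem {s : Set (ℝ × ℝ)} (hs : IsPreconnected s) (hsC : s ⊆ C.supportᶜ)
    {z w : ℝ × ℝ} (hz : z ∈ s) (hw : w ∈ s) : C.component z = C.component w :=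
  connectedComponentIn_eq (hs.subset_connectedComponentIn hz hsC hw)

lemma component_eq_of_horizontal {y x₁ x₂ : ℝ} (h : x₁ ≤ x₂)
    (hC : ∀ x ∈ Icc x₁ x₂, (x, y) ∉ C.support) :
    C.component (x₁, y) = C.component (x₂, y) := by
  have hs : IsPreconnected ((fun x : ℝ => (x, y)) '' Icc x₁ x₂) :=
    isPreconnected_Icc.image _ (by fun_prop)
  refine C.component_eq_of_mem hs ?_ ⟨x₁, ⟨le_rfl, h⟩, rfl⟩ ⟨x₂, ⟨h, le_rfl⟩, rfl⟩
  rintro _ ⟨x, hx, rfl⟩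
  exact hC x hx

lemma component_eq_of_vertical {x y₁ y₂ : ℝ} (h : y₁ ≤ y₂)
    (hC : ∀ y ∈ Icc y₁ y₂, (x, y) ∉ C.support) :
    C.component (x, y₁) = C.component (x, y₂) := by
  have hs : IsPreconnected ((fun y : ℝ => (x, y)) '' Icc y₁ y₂) :=
    isPreconnected_Icc.image _ (by fun_prop)
  refine C.component_eq_of_mem hs ?_ ⟨y₁, ⟨le_rfl, h⟩, rfl⟩ ⟨y₂, ⟨h, le_rfl⟩, rfl⟩
  rintro _ ⟨y, hy, rfl⟩
  exact hC y hy

lemma not_isBounded_component_of_ray {z v : ℝ × ℝ} (hv : v ≠ 0)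
    (hray : ∀ t : ℝ, 0 ≤ t → z + t • v ∉ C.support) : ¬Bornology.IsBounded (C.component z) := by
  intro hb
  obtain ⟨r, hr⟩ := hb.subset_closedBall z
  have hs : IsPreconnected ((fun t : ℝ => z + t • v) '' Ici 0) :=
    isPreconnected_Ici.image _ (by fun_prop)
  have hsub : (fun t : ℝ => z + t • v) '' Ici 0 ⊆ C.component z :=
    hs.subset_connectedComponentIn ⟨0, self_mem_Ici, by simp⟩
      (by rintro _ ⟨t, ht, rfl⟩; exact hray t ht)
  have hfar : 0 ≤ (|r| + 1) / ‖v‖ := by positivity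
  have hmem := hr (hsub ⟨_, hfar, rfl⟩)
  rw [Metric.mem_closedBall, dist_eq_norm, add_sub_cancel_left, norm_smul,
    Real.norm_of_nonneg hfar, div_mul_cancel₀ _ (norm_ne_zero_iff.2 hv)] at hmem
  linarith [le_abs_self r]

variable [Finite ι]

lemma isClosed_support : IsClosed C.support := by
  simpa [support] using C.isClosed_setOf_exists_mem_trace fun _ => True

lemma exists_tube (i : ι) {σ : ℝ} (hσ : σ ≠ 0) {y₀ : ℝ} (hy₀ : y₀ ∈ Ioo (C.lo i) (C.hi i)) :
    ∃ F, ∀ᶠ p : ℝ × ℝ in 𝓝 y₀ ×ˢ 𝓝[>] 0, (C.curve i p.1 + σ * p.2, p.1) ∉ C.support ∧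
      C.component (C.curve i p.1 + σ * p.2, p.1) = F := by
  have hcont := C.continuous_curve i
  have hg : Continuous fun p : ℝ × ℝ => (C.curve i p.1 + σ * p.2, p.1) := by fun_prop
  have hothers : ∀ᶠ p : ℝ × ℝ in 𝓝 (y₀, 0), ¬∃ j, j ≠ i ∧
      (C.curve i p.1 + σ * p.2, p.1) ∈ C.trace j := by
    refine hg.continuousAt.eventually
      ((C.isClosed_setOf_exists_mem_trace (· ≠ i)).isOpen_compl.mem_nhds ?_)
    rintro ⟨j, hj, hyj, hxj⟩
    exact C.curve_ne i j y₀ hj.symm hy₀ hyj (by simpa using hxj)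
  obtain ⟨ε, hε, hball⟩ := Metric.eventually_nhds_iff.1 hothers
  have hs : IsPreconnected ((fun p : ℝ × ℝ => (C.curve i p.1 + σ * p.2, p.1)) ''
      (Ioo (y₀ - ε) (y₀ + ε) ×ˢ Ioo 0 ε)) :=
    (isPreconnected_Ioo.prod isPreconnected_Ioo).image _ hg.continuousOn
  have hout : (fun p : ℝ × ℝ => (C.curve i p.1 + σ * p.2, p.1)) ''
      (Ioo (y₀ - ε) (y₀ + ε) ×ˢ Ioo 0 ε) ⊆ C.supportᶜ := by
    rintro _ ⟨⟨y, t⟩, ⟨hy, ht⟩, rfl⟩ ⟨j, hj⟩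
    rcases eq_or_ne j i with rfl | hji
    · exact mul_ne_zero hσ ht.1.ne' (by simpa using hj.2)
    · refine hball ?_ ⟨j, hji, hj⟩
      rw [Prod.dist_eq, Real.dist_eq, Real.dist_eq]
      exact max_lt (abs_lt.2 ⟨by linarith [hy.1], by linarith [hy.2]⟩)
        (abs_lt.2 ⟨by linarith [ht.1], by linarith [ht.2]⟩)
  refine ⟨C.component (C.curve i y₀ + σ * (ε / 2), y₀), ?_⟩
  filter_upwards [prod_mem_prod (Ioo_mem_nhds (sub_lt_self y₀ hε) (lt_add_of_pos_right y₀ hε))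
    (Ioo_mem_nhdsGT hε)] with p hp
  exact ⟨hout ⟨p, hp, rfl⟩, C.component_eq_of_mem hs hout ⟨p, hp, rfl⟩
    ⟨(y₀, ε / 2), ⟨⟨by linarith, by linarith⟩, ⟨by linarith, by linarith⟩⟩, rfl⟩⟩

lemma exists_sideFace (i : ι) {σ : ℝ} (hσ : σ ≠ 0) :
    ∃ F, ∀ y ∈ Ioo (C.lo i) (C.hi i), ∀ᶠ t in 𝓝[>] (0 : ℝ),
      (C.curve i y + σ * t, y) ∉ C.support ∧ C.component (C.curve i y + σ * t, y) = F := by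
  have hlocal : ∀ y₀ ∈ Ioo (C.lo i) (C.hi i), ∃ F, ∀ᶠ y in 𝓝 y₀, ∀ᶠ t in 𝓝[>] (0 : ℝ),
      (C.curve i y + σ * t, y) ∉ C.support ∧ C.component (C.curve i y + σ * t, y) = F :=
    fun y₀ hy₀ => (C.exists_tube i hσ hy₀).imp fun F hF => hF.curry
  choose! F hF using hlocal
  have hconst : ∀ y₀ ∈ Ioo (C.lo i) (C.hi i), ∀ᶠ y in 𝓝[Ioo (C.lo i) (C.hi i)] y₀,
      F y₀ = F y := by
    intro y₀ hy₀
    filter_upwards [nhdsWithin_le_nhds (hF y₀ hy₀), self_mem_nhdsWithin] with y hy₀y hy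
    obtain ⟨t, ⟨-, ht₀⟩, -, ht⟩ := (hy₀y.and (hF y hy).self_of_nhds).exists
    exact ht₀.symm.trans ht
  obtain ⟨c, hc⟩ := exists_between (C.lo_lt_hi i)
  refine ⟨F c, fun y hy => ?_⟩
  have hcy : F c = F y := isPreconnected_Ioo.induction₂ (fun a b => F a = F b) hconst
    (fun _ _ _ _ _ _ => Eq.trans) (fun _ _ _ _ => Eq.symm) hc hy
  rw [hcy]
  exact (hF y hy).self_of_nhds

/-- The component that lies along the left side of a curve. -/
def leftFace (i : ι) : Set (ℝ × ℝ) :=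
  (C.exists_sideFace i (σ := -1) (by norm_num)).choose

/-- The component that lies along the right side of a curve. -/
def rightFace (i : ι) : Set (ℝ × ℝ) :=
  (C.exists_sideFace i (σ := 1) (by norm_num)).choose

lemma eventually_component_eq_leftFace (i : ι) {y : ℝ} (hy : y ∈ Ioo (C.lo i) (C.hi i)) :
    ∀ᶠ x in 𝓝[<] (C.curve i y), (x, y) ∉ C.support ∧ C.component (x, y) = C.leftFace i := by
  have ht : Tendsto (fun x => C.curve i y - x) (𝓝[<] (C.curve i y)) (𝓝[>] (0 : ℝ)) := by
    refine tendsto_nhdsWithin_iff.2 ⟨?_, by filter_upwards [self_mem_nhdsWithin] with x hx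
                                            using sub_pos.2 (mem_Iio.1 hx)⟩
    have hcont : Continuous fun x => C.curve i y - x := by fun_prop
    simpa using (hcont.tendsto (C.curve i y)).mono_left nhdsWithin_le_nhds
  filter_upwards [ht.eventually
    ((C.exists_sideFace i (σ := -1) (by norm_num)).choose_spec y hy)] with x hx
  simpa [leftFace] using hx

lemma eventually_component_eq_rightFace (i : ι) {y : ℝ} (hy : y ∈ Ioo (C.lo i) (C.hi i)) :
    ∀ᶠ x in 𝓝[>] (C.curve i y), (x, y) ∉ C.support ∧ C.component (x, y) = C.rightFace i := by
  have ht : Tendsto (fun x => x - C.curve i y) (𝓝[>] (C.curve i y)) (𝓝[>] (0 : ℝ)) := by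
    refine tendsto_nhdsWithin_iff.2 ⟨?_, by filter_upwards [self_mem_nhdsWithin] with x hx
                                            using sub_pos.2 (mem_Ioi.1 hx)⟩
    have hcont : Continuous fun x => x - C.curve i y := by fun_prop
    simpa using (hcont.tendsto (C.curve i y)).mono_left nhdsWithin_le_nhds
  filter_upwards [ht.eventually
    ((C.exists_sideFace i (σ := 1) (by norm_num)).choose_spec y hy)] with x hx
  simpa [rightFace] using hx

lemma eventually_mem_leftFace (i : ι) {y : ℝ} (hy : y ∈ Ioo (C.lo i) (C.hi i)) :
    ∀ᶠ x in 𝓝[<] (C.curve i y), (x, y) ∈ C.leftFace i := by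
  filter_upwards [C.eventually_component_eq_leftFace i hy] with x ⟨hx, hF⟩
  exact hF ▸ mem_connectedComponentIn hx

lemma eventually_mem_rightFace (i : ι) {y : ℝ} (hy : y ∈ Ioo (C.lo i) (C.hi i)) :
    ∀ᶠ x in 𝓝[>] (C.curve i y), (x, y) ∈ C.rightFace i := by
  filter_upwards [C.eventually_component_eq_rightFace i hy] with x ⟨hx, hF⟩
  exact hF ▸ mem_connectedComponentIn hx

lemma component_eq_leftFace {i : ι} {x y : ℝ} (hy : y ∈ Ioo (C.lo i) (C.hi i))
    (hx : x < C.curve i y) (hC : ∀ x' ∈ Ico x (C.curve i y), (x', y) ∉ C.support) :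
    C.component (x, y) = C.leftFace i := by
  obtain ⟨a, ⟨-, ha⟩, hxa, hai⟩ :=
    ((C.eventually_component_eq_leftFace i hy).and (Ioo_mem_nhdsLT hx)).exists
  rw [← ha]
  exact C.component_eq_of_horizontal hxa.le fun x' hx' => hC x' ⟨hx'.1, hx'.2.trans_lt hai⟩

lemma component_eq_rightFace {i : ι} {x y : ℝ} (hy : y ∈ Ioo (C.lo i) (C.hi i))
    (hx : C.curve i y < x) (hC : ∀ x' ∈ Ioc (C.curve i y) x, (x', y) ∉ C.support) :
    C.component (x, y) = C.rightFace i := by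
  obtain ⟨a, ⟨-, ha⟩, hia, hax⟩ :=
    ((C.eventually_component_eq_rightFace i hy).and (Ioo_mem_nhdsGT hx)).exists
  rw [← ha]
  exact (C.component_eq_of_horizontal hax.le
    fun x' hx' => hC x' ⟨hia.trans_le hx'.1, hx'.2⟩).symm

lemma exists_component_eq_leftFace {x y : ℝ} (hxy : (x, y) ∉ C.support)
    (hy : ∀ i, y ∈ Icc (C.lo i) (C.hi i) → y ∈ Ioo (C.lo i) (C.hi i))
    (hex : ∃ i, y ∈ Icc (C.lo i) (C.hi i) ∧ x < C.curve i y) :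
    ∃ i, y ∈ Ioo (C.lo i) (C.hi i) ∧ x < C.curve i y ∧ C.component (x, y) = C.leftFace i := by
  obtain ⟨i, ⟨hi, hix⟩, hmin⟩ := Set.exists_min_image
    {i | y ∈ Icc (C.lo i) (C.hi i) ∧ x < C.curve i y} (fun i => C.curve i y) (Set.toFinite _) hex
  refine ⟨i, hy i hi, hix, C.component_eq_leftFace (hy i hi) hix ?_⟩
  rintro b ⟨hxb, hbi⟩ ⟨j, hj, rfl : b = C.curve j y⟩
  rcases hxb.eq_or_lt with rfl | hxb
  · exact hxy ⟨j, hj, rfl⟩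
  · exact hbi.not_ge (hmin j ⟨hj, hxb⟩)

lemma exists_component_eq_rightFace {x y : ℝ} (hxy : (x, y) ∉ C.support)
    (hy : ∀ i, y ∈ Icc (C.lo i) (C.hi i) → y ∈ Ioo (C.lo i) (C.hi i))
    (hex : ∃ i, y ∈ Icc (C.lo i) (C.hi i) ∧ C.curve i y < x) :
    ∃ i, y ∈ Ioo (C.lo i) (C.hi i) ∧ C.curve i y < x ∧ C.component (x, y) = C.rightFace i := by
  obtain ⟨i, ⟨hi, hix⟩, hmax⟩ := Set.exists_max_image
    {i | y ∈ Icc (C.lo i) (C.hi i) ∧ C.curve i y < x} (fun i => C.curve i y) (Set.toFinite _) hex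
  refine ⟨i, hy i hi, hix, C.component_eq_rightFace (hy i hi) hix ?_⟩
  rintro b ⟨hib, hbx⟩ ⟨j, hj, rfl : b = C.curve j y⟩
  rcases hbx.eq_or_lt with rfl | hbx
  · exact hxy ⟨j, hj, rfl⟩
  · exact hib.not_ge (hmax j ⟨hj, hbx⟩)

section Jump

variable {M : Type*} [AddCommGroup M] (g : Set (ℝ × ℝ) → M)

/-- The jump of a function of the components across a curve, from left to right. -/
def jump (i : ι) : M := g (C.rightFace i) - g (C.leftFace i)

lemma sum_jump_horizontal {y x₁ x₂ : ℝ} (hx : x₁ < x₂) (h₁ : (x₁, y) ∉ C.support)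
    (h₂ : (x₂, y) ∉ C.support) (A : Finset ι)
    (hA : ∀ i, i ∈ A ↔ y ∈ Icc (C.lo i) (C.hi i) ∧ C.curve i y ∈ Ioo x₁ x₂)
    (hint : ∀ i ∈ A, y ∈ Ioo (C.lo i) (C.hi i)) :
    ∑ i ∈ A, C.jump g i = g (C.component (x₂, y)) - g (C.component (x₁, y)) := by
  classical
  induction A using Finset.induction_on_max_value (fun i => C.curve i y) generalizing x₂ with
  | empty =>
    rw [C.component_eq_of_horizontal hx.le, Finset.sum_empty, sub_self]
    rintro x ⟨hx₁, hx₂⟩ ⟨i, hi, rfl : x = C.curve i y⟩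
    rcases hx₁.eq_or_lt with rfl | hx₁
    · exact h₁ ⟨i, hi, rfl⟩
    rcases hx₂.eq_or_lt with rfl | hx₂
    · exact h₂ ⟨i, hi, rfl⟩
    · exact Finset.notMem_empty i ((hA i).2 ⟨hi, hx₁, hx₂⟩)
  | insert i s his hmax ih =>
    obtain ⟨-, hx₁i, hix₂⟩ := (hA i).1 (Finset.mem_insert_self i s)
    have hyi := hint i (Finset.mem_insert_self i s)
    have hright : C.component (x₂, y) = C.rightFace i := by
      refine C.component_eq_rightFace hyi hix₂ ?_
      rintro x ⟨hix, hxx₂⟩ ⟨j, hj, rfl : x = C.curve j y⟩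
      rcases hxx₂.eq_or_lt with rfl | hxx₂
      · exact h₂ ⟨j, hj, rfl⟩
      rcases Finset.mem_insert.1 ((hA j).2 ⟨hj, hx₁i.trans hix, hxx₂⟩) with rfl | hjs
      · exact lt_irrefl _ hix
      · exact hix.not_ge (hmax j hjs)
    have hgap : ∀ᶠ x in 𝓝[<] (C.curve i y), ∀ j ∈ s, C.curve j y < x := by
      rw [Filter.eventually_all_finset]
      intro j hj
      have hne : i ≠ j := by rintro rfl; exact his hj
      exact nhdsWithin_le_nhds (Ioi_mem_nhds ((hmax j hj).lt_of_ne
        (C.curve_ne i j y hne hyi ((hA j).1 (Finset.mem_insert_of_mem hj)).1).symm))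
    obtain ⟨b, ⟨⟨hb, hleft⟩, hx₁b, hbi⟩, hsb⟩ :=
      (((C.eventually_component_eq_leftFace i hyi).and (Ioo_mem_nhdsLT hx₁i)).and hgap).exists
    have hs : ∀ j, j ∈ s ↔ y ∈ Icc (C.lo j) (C.hi j) ∧ C.curve j y ∈ Ioo x₁ b := by
      refine fun j => ⟨fun hj => ?_, fun ⟨hj, hx₁j, hjb⟩ => ?_⟩
      · obtain ⟨hyj, hx₁j, -⟩ := (hA j).1 (Finset.mem_insert_of_mem hj)
        exact ⟨hyj, hx₁j, hsb j hj⟩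
      · refine Finset.mem_of_mem_insert_of_ne ((hA j).2 ⟨hj, hx₁j, hjb.trans (hbi.trans hix₂)⟩) ?_
        rintro rfl
        exact lt_asymm hjb hbi
    rw [Finset.sum_insert his, ih hx₁b hb hs fun j hj => hint j (Finset.mem_insert_of_mem hj),
      hright, hleft, jump]
    abel

lemma exists_box (v : ℝ × ℝ) :
    ∃ r > 0, ∀ᶠ y in 𝓝 v.2, ∀ i, (v ∈ C.trace i → |C.curve i y - v.1| < r) ∧
      (y ∈ Icc (C.lo i) (C.hi i) → |C.curve i y - v.1| ≤ r → v ∈ C.trace i) := by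
  have hv : v ∉ {z | ∃ i, v ∉ C.trace i ∧ z ∈ C.trace i} := fun ⟨_, hi, hi'⟩ => hi hi'
  obtain ⟨r, hr, hball⟩ := Metric.eventually_nhds_iff.1
    ((C.isClosed_setOf_exists_mem_trace (v ∉ C.trace ·)).isOpen_compl.mem_nhds hv)
  refine ⟨r / 2, half_pos hr, eventually_all.2 fun i => (?_ : ∀ᶠ y in 𝓝 v.2, _).and ?_⟩
  · by_cases hi : v ∈ C.trace i
    · have hlim : Tendsto (fun y => |C.curve i y - v.1|) (𝓝 v.2) (𝓝 |C.curve i v.2 - v.1|) :=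
        ((C.continuous_curve i).sub continuous_const).abs.tendsto v.2
      rw [← hi.2, sub_self, abs_zero] at hlim
      filter_upwards [hlim.eventually (Iio_mem_nhds (half_pos hr))] with y hy _ using hy
    · exact .of_forall fun y h => absurd h hi
  · filter_upwards [Metric.ball_mem_nhds v.2 hr] with y hy hyi hxi
    by_contra hi
    have hdist : dist (C.curve i y, y) v < r := by
      rw [Prod.dist_eq, Real.dist_eq]
      exact max_lt (by linarith) hy
    exact hball hdist ⟨i, hi, hyi, rfl⟩

lemma exists_sum_jump_near (v : ℝ × ℝ) :
    ∃ r > 0, ∀ᶠ y in 𝓝 v.2, (v.1 - r, y) ∉ C.support ∧ (v.1 + r, y) ∉ C.support ∧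
      ∀ A : Finset ι, (∀ i, i ∈ A ↔ v ∈ C.trace i ∧ y ∈ Icc (C.lo i) (C.hi i)) →
        (∀ i ∈ A, y ∈ Ioo (C.lo i) (C.hi i)) →
        ∑ i ∈ A, C.jump g i =
          g (C.component (v.1 + r, y)) - g (C.component (v.1 - r, y)) := by
  obtain ⟨r, hr, hbox⟩ := C.exists_box v
  refine ⟨r, hr, ?_⟩
  filter_upwards [hbox] with y hy
  have hside : ∀ x, |x - v.1| = r → (x, y) ∉ C.support := by
    rintro x hx ⟨i, hi, rfl : x = C.curve i y⟩
    exact ((hy i).1 ((hy i).2 hi hx.le)).ne hx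
  have hleft := hside (v.1 - r) (by simp [abs_of_pos hr])
  have hright := hside (v.1 + r) (by simp [abs_of_pos hr])
  refine ⟨hleft, hright, fun A hA hint =>
    C.sum_jump_horizontal g (by linarith) hleft hright A (fun i => ?_) hint⟩
  have hIoo : C.curve i y ∈ Ioo (v.1 - r) (v.1 + r) ↔ |C.curve i y - v.1| < r := by
    rw [← Real.ball_eq_Ioo, Metric.mem_ball, Real.dist_eq]
  rw [hA, and_comm, hIoo]
  exact and_congr_right fun hyi => ⟨(hy i).1, fun h => (hy i).2 hyi h.le⟩

/-- Both sums are the change of `g` from the left to the right of a small box around the point. -/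
lemma sum_jump_eq_sum_jump (v : ℝ × ℝ) (I O : Finset ι)
    (hI : ∀ i, i ∈ I ↔ C.hi i = v.2 ∧ v ∈ C.trace i)
    (hO : ∀ i, i ∈ O ↔ C.lo i = v.2 ∧ v ∈ C.trace i)
    (hv : ∀ i, v ∈ C.trace i → C.hi i = v.2 ∨ C.lo i = v.2) :
    ∑ i ∈ I, C.jump g i = ∑ i ∈ O, C.jump g i := by
  obtain ⟨r, -, hsum⟩ := C.exists_sum_jump_near g v
  have hlong : ∀ᶠ y in 𝓝 v.2, (∀ i ∈ I, C.lo i < y) ∧ ∀ i ∈ O, y < C.hi i := by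
    refine Filter.Eventually.and ?_ ?_ <;> rw [Filter.eventually_all_finset] <;> intro i hi
    · exact Ioi_mem_nhds (((hI i).1 hi).1 ▸ C.lo_lt_hi i)
    · exact Iio_mem_nhds (((hO i).1 hi).1 ▸ C.lo_lt_hi i)
  obtain ⟨δ, hδ, hnear⟩ := Metric.eventually_nhds_iff.1 (hsum.and hlong)
  simp only [Real.dist_eq] at hnear
  have hcolumn : ∀ x, x = v.1 - r ∨ x = v.1 + r →
      C.component (x, v.2 - δ / 2) = C.component (x, v.2 + δ / 2) := by
    refine fun x hx => C.component_eq_of_vertical (by linarith) fun y hy => ?_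
    obtain ⟨⟨hleft, hright, -⟩, -⟩ :=
      hnear (y := y) (abs_lt.2 ⟨by linarith [hy.1], by linarith [hy.2]⟩)
    rcases hx with rfl | rfl
    · exact hleft
    · exact hright
  obtain ⟨⟨-, -, hdown⟩, hlo, -⟩ :=
    hnear (y := v.2 - δ / 2) (abs_lt.2 ⟨by linarith, by linarith⟩)
  obtain ⟨⟨-, -, hup⟩, -, hhi⟩ :=
    hnear (y := v.2 + δ / 2) (abs_lt.2 ⟨by linarith, by linarith⟩)
  have hIint : ∀ i ∈ I, v.2 - δ / 2 ∈ Ioo (C.lo i) (C.hi i) := fun i hi =>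
    ⟨hlo i hi, by linarith [((hI i).1 hi).1]⟩
  have hOint : ∀ i ∈ O, v.2 + δ / 2 ∈ Ioo (C.lo i) (C.hi i) := fun i hi =>
    ⟨by linarith [((hO i).1 hi).1], hhi i hi⟩
  rw [hdown I (fun i => ?_) hIint, hup O (fun i => ?_) hOint, hcolumn _ (.inl rfl),
    hcolumn _ (.inr rfl)]
  · refine ⟨fun hi => ⟨((hO i).1 hi).2, Ioo_subset_Icc_self (hOint i hi)⟩, fun ⟨hi, hy⟩ => ?_⟩
    exact (hO i).2 ⟨(hv i hi).resolve_left fun h => by linarith [hy.2], hi⟩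
  · refine ⟨fun hi => ⟨((hI i).1 hi).2, Ioo_subset_Icc_self (hIint i hi)⟩, fun ⟨hi, hy⟩ => ?_⟩
    exact (hI i).2 ⟨(hv i hi).resolve_right fun h => by linarith [hy.1], hi⟩

end Jump

end CurveSystem

/-! ### Flows in finite directed graphs -/

section NetInflow

variable {V E : Type*} [DecidableEq V] [Fintype E]

/-- The net flow into the vertex `v` of a directed graph with tails `s` and heads `t` that carries
the flow `c`: what enters `v` minus what leaves it. -/
def netInflow {R : Type*} [AddCommGroup R] (s t : E → V) (c : E → R) (v : V) : R :=
  ∑ e with t e = v, c e - ∑ e with s e = v, c e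

variable {R : Type*} [Ring R]

lemma sum_mul_sub_eq_sum_netInflow_mul [Fintype V] (s t : E → V) (c : E → R) (f : V → R) :
    ∑ e, c e * (f (t e) - f (s e)) = ∑ v, netInflow s t c v * f v := by
  have hfiber : ∀ u : E → V, ∑ v, (∑ e with u e = v, c e) * f v = ∑ e, c e * f (u e) := by
    intro u
    rw [← Finset.sum_fiberwise Finset.univ u]
    refine Finset.sum_congr rfl fun v _ => ?_
    rw [Finset.sum_mul]
    exact Finset.sum_congr rfl fun e he => by rw [(Finset.mem_filter.1 he).2]
  simp only [netInflow, sub_mul, mul_sub, Finset.sum_sub_distrib, hfiber]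

lemma sum_mul_sub_of_netInflow_eq_zero [Finite V] {s t : E → V} {c : E → R} {a b : V}
    (hab : a ≠ b) (h : ∀ v, v ≠ a → v ≠ b → netInflow s t c v = 0) (f : V → R) :
    ∑ e, c e * (f (t e) - f (s e)) = -netInflow s t c a * (f b - f a) := by
  have := Fintype.ofFinite V
  have htwo : ∀ f : V → R, ∑ e, c e * (f (t e) - f (s e)) =
      netInflow s t c a * f a + netInflow s t c b * f b := fun f => by
    rw [sum_mul_sub_eq_sum_netInflow_mul, Finset.sum_eq_add a b hab]
    · exact fun v _ hv => by rw [h v hv.1 hv.2, zero_mul]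
    · simp
    · simp
  have hconst := htwo fun _ => 1
  simp only [sub_self, mul_zero, Finset.sum_const_zero, mul_one] at hconst
  rw [htwo f, eq_neg_of_add_eq_zero_right hconst.symm, mul_sub, neg_mul, neg_mul]
  abel

end NetInflow

/-! ### Faces of a drawing -/

instance instFinitePosetHat (P : Type*) [Finite P] : Finite (PosetHat P) :=
  inferInstanceAs (Finite (Option (Option P)))

namespace HasseDrawing

variable {P : Type*} [PartialOrder P] (D : HasseDrawing P)

lemma height_lt (e : HasseEdge P) : (D.pos e.1.1).2 < (D.pos e.1.2).2 :=
  D.height_strictMono e.2.lt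

lemma bot_le_height (v : PosetHat P) : (D.pos ⊥).2 ≤ (D.pos v).2 :=
  D.height_strictMono.monotone bot_le

lemma height_le_top (v : PosetHat P) : (D.pos v).2 ≤ (D.pos ⊤).2 :=
  D.height_strictMono.monotone le_top

lemma bot_lt_height {v : PosetHat P} (hv : v ≠ ⊥) : (D.pos ⊥).2 < (D.pos v).2 :=
  D.height_strictMono (bot_lt_iff_ne_bot.2 hv)

lemma height_lt_top {v : PosetHat P} (hv : v ≠ ⊤) : (D.pos v).2 < (D.pos ⊤).2 :=
  D.height_strictMono (lt_top_iff_ne_top.2 hv)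

lemma exists_edge_at_height [Finite P] {y : ℝ} (hbot : (D.pos ⊥).2 ≤ y) (htop : y < (D.pos ⊤).2) :
    ∃ e : HasseEdge P, y ∈ Ico (D.pos e.1.1).2 (D.pos e.1.2).2 := by
  obtain ⟨a, hay, hmax⟩ :=
    (Set.toFinite {a : PosetHat P | (D.pos a).2 ≤ y}).exists_maximal ⟨⊥, hbot⟩
  have hne : a ≠ ⊤ := by
    rintro rfl
    exact htop.not_ge hay
  obtain ⟨b, hab, -⟩ := exists_covBy_le_of_lt (lt_top_iff_ne_top.2 hne)
  exact ⟨⟨(a, b), hab⟩, hay, lt_of_not_ge fun hby => hab.lt.not_ge (hmax hby hab.le)⟩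

lemma curve_ne_of_ne {e e' : HasseEdge P} {y : ℝ} (hne : e ≠ e')
    (hy : y ∈ Ioo (D.pos e.1.1).2 (D.pos e.1.2).2)
    (hy' : y ∈ Icc (D.pos e'.1.1).2 (D.pos e'.1.2).2) : D.curve e y ≠ D.curve e' y := by
  intro h
  obtain ⟨v, hv⟩ := D.curve_inter e e' y hne (Ioo_subset_Icc_self hy) hy' h
  obtain ⟨hv₁, rfl⟩ := Prod.ext_iff.1 hv
  rcases D.vertex_on_curve e v (Ioo_subset_Icc_self hy) hv₁.symm with rfl | rfl
  · exact lt_irrefl _ hy.1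
  · exact lt_irrefl _ hy.2

end HasseDrawing

namespace AugmentedDrawing

variable {P : Type*} [PartialOrder P] (D : AugmentedDrawing P)

lemma height_bot_lt_height_top : (D.pos ⊥).2 < (D.pos ⊤).2 := D.height_strictMono bot_lt_top

lemma mem_Ioo_bot_top {e : HasseEdge P} {y : ℝ}
    (hy : y ∈ Ioo (D.pos e.1.1).2 (D.pos e.1.2).2) : y ∈ Ioo (D.pos ⊥).2 (D.pos ⊤).2 :=
  ⟨(D.bot_le_height _).trans_lt hy.1, hy.2.trans_le (D.height_le_top _)⟩

variable [Finite P]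

lemma left_lt_right {y : ℝ} (hy : y ∈ Ioo (D.pos ⊥).2 (D.pos ⊤).2) :
    D.leftCurve y < D.rightCurve y := by
  obtain ⟨e, he⟩ := D.exists_edge_at_height hy.1.le hy.2
  exact (D.left_lt y hy e (Ico_subset_Icc_self he)).trans
    (D.lt_right y hy e (Ico_subset_Icc_self he))

/-- The curves of the augmented drawing, extended by constants to all heights. The left and the
right additional edge are indexed by `Sum.inr false` and `Sum.inr true`. -/
def curves : CurveSystem (HasseEdge P ⊕ Bool) where
  lo := Sum.elim (fun e => (D.pos e.1.1).2) fun _ => (D.pos ⊥).2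
  hi := Sum.elim (fun e => (D.pos e.1.2).2) fun _ => (D.pos ⊤).2
  lo_lt_hi := by
    rintro (e | _)
    · exact D.height_lt e
    · exact D.height_bot_lt_height_top
  curve := Sum.elim (fun e => IccExtend (D.height_lt e).le ((Icc _ _).domRestrict (D.curve e)))
    fun b => IccExtend D.height_bot_lt_height_top.le
      ((Icc _ _).domRestrict (bif b then D.rightCurve else D.leftCurve))
  continuous_curve := by
    rintro (e | _ | _)
    · exact (D.curve_continuousOn e).domRestrict.Icc_extend'
    · exact D.left_continuousOn.domRestrict.Icc_extend'
    · exact D.right_continuousOn.domRestrict.Icc_extend'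
  curve_ne := by
    rintro (e | b) (e' | b') y hne hy hy' h <;>
      simp only [Sum.elim_inl, Sum.elim_inr] at hy hy' h <;>
      rw [IccExtend_of_mem _ _ (Ioo_subset_Icc_self hy), IccExtend_of_mem _ _ hy'] at h <;>
      simp only [domRestrict_apply] at h
    · exact D.curve_ne_of_ne (fun h => hne (by rw [h])) hy hy' h
    · cases b'
      · exact (D.left_lt y (D.mem_Ioo_bot_top hy) e (Ioo_subset_Icc_self hy)).ne' h
      · exact (D.lt_right y (D.mem_Ioo_bot_top hy) e (Ioo_subset_Icc_self hy)).ne h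
    · cases b
      · exact (D.left_lt y hy e' hy').ne h
      · exact (D.lt_right y hy e' hy').ne' h
    · have := D.left_lt_right hy
      cases b <;> cases b' <;> simp at h hne <;> linarith

lemma curves_inl {e : HasseEdge P} {y : ℝ} (hy : y ∈ Icc (D.pos e.1.1).2 (D.pos e.1.2).2) :
    D.curves.curve (.inl e) y = D.curve e y :=
  IccExtend_of_mem (D.height_lt e).le ((Icc _ _).domRestrict (D.curve e)) hy

lemma curves_left {y : ℝ} (hy : y ∈ Icc (D.pos ⊥).2 (D.pos ⊤).2) :
    D.curves.curve (.inr false) y = D.leftCurve y :=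
  IccExtend_of_mem D.height_bot_lt_height_top.le ((Icc _ _).domRestrict D.leftCurve) hy

lemma curves_right {y : ℝ} (hy : y ∈ Icc (D.pos ⊥).2 (D.pos ⊤).2) :
    D.curves.curve (.inr true) y = D.rightCurve y :=
  IccExtend_of_mem D.height_bot_lt_height_top.le ((Icc _ _).domRestrict D.rightCurve) hy

lemma support_curves : D.curves.support = D.support := by
  ext ⟨x, y⟩
  constructor
  · rintro ⟨e | _ | _, hy, hx⟩
    · exact .inl ⟨e, hy, hx.trans (D.curves_inl hy)⟩
    · exact .inr ⟨hy, .inl (hx.trans (D.curves_left hy))⟩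
    · exact .inr ⟨hy, .inr (hx.trans (D.curves_right hy))⟩
  · rintro (⟨e, hy, hx⟩ | ⟨hy, hx | hx⟩)
    · exact ⟨.inl e, hy, hx.trans (D.curves_inl hy).symm⟩
    · exact ⟨.inr false, hy, hx.trans (D.curves_left hy).symm⟩
    · exact ⟨.inr true, hy, hx.trans (D.curves_right hy).symm⟩

lemma Icc_lo_hi_subset (i : HasseEdge P ⊕ Bool) :
    Icc (D.curves.lo i) (D.curves.hi i) ⊆ Icc (D.pos ⊥).2 (D.pos ⊤).2 := by
  rcases i with e | b
  · exact Icc_subset_Icc (D.bot_le_height _) (D.height_le_top _)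
  · exact subset_rfl

lemma curves_left_le (i : HasseEdge P ⊕ Bool) {y : ℝ}
    (hy : y ∈ Icc (D.curves.lo i) (D.curves.hi i)) :
    D.curves.curve (.inr false) y ≤ D.curves.curve i y := by
  rw [← closure_Ioo (D.curves.lo_lt_hi i).ne] at hy
  refine le_on_closure (fun z hz => ?_) (D.curves.continuous_curve _).continuousOn
    (D.curves.continuous_curve _).continuousOn hy
  rw [D.curves_left (D.Icc_lo_hi_subset i (Ioo_subset_Icc_self hz))]
  rcases i with e | _ | _
  · rw [D.curves_inl (Ioo_subset_Icc_self hz)]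
    exact (D.left_lt z (D.mem_Ioo_bot_top hz) e (Ioo_subset_Icc_self hz)).le
  · exact (D.curves_left (Ioo_subset_Icc_self hz)).ge
  · rw [D.curves_right (Ioo_subset_Icc_self hz)]
    exact (D.left_lt_right hz).le

lemma le_curves_right (i : HasseEdge P ⊕ Bool) {y : ℝ}
    (hy : y ∈ Icc (D.curves.lo i) (D.curves.hi i)) :
    D.curves.curve i y ≤ D.curves.curve (.inr true) y := by
  rw [← closure_Ioo (D.curves.lo_lt_hi i).ne] at hy
  refine le_on_closure (fun z hz => ?_) (D.curves.continuous_curve _).continuousOn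
    (D.curves.continuous_curve _).continuousOn hy
  rw [D.curves_right (D.Icc_lo_hi_subset i (Ioo_subset_Icc_self hz))]
  rcases i with e | _ | _
  · rw [D.curves_inl (Ioo_subset_Icc_self hz)]
    exact (D.lt_right z (D.mem_Ioo_bot_top hz) e (Ioo_subset_Icc_self hz)).le
  · rw [D.curves_left (Ioo_subset_Icc_self hz)]
    exact (D.left_lt_right hz).le
  · exact (D.curves_right (Ioo_subset_Icc_self hz)).le

lemma curves_left_lt {i : HasseEdge P ⊕ Bool} (hi : i ≠ .inr false) {y : ℝ}
    (hy : y ∈ Ioo (D.curves.lo i) (D.curves.hi i)) :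
    D.curves.curve (.inr false) y < D.curves.curve i y :=
  (D.curves_left_le i (Ioo_subset_Icc_self hy)).lt_of_ne
    (D.curves.curve_ne _ _ y hi hy (D.Icc_lo_hi_subset i (Ioo_subset_Icc_self hy))).symm

lemma lt_curves_right {i : HasseEdge P ⊕ Bool} (hi : i ≠ .inr true) {y : ℝ}
    (hy : y ∈ Ioo (D.curves.lo i) (D.curves.hi i)) :
    D.curves.curve i y < D.curves.curve (.inr true) y :=
  (D.le_curves_right i (Ioo_subset_Icc_self hy)).lt_of_ne
    (D.curves.curve_ne _ _ y hi hy (D.Icc_lo_hi_subset i (Ioo_subset_Icc_self hy)))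

/-- The open region between the two additional edges; the bounded faces are the components of the
complement of the drawing in it. -/
def region : Set (ℝ × ℝ) :=
  {z | z.2 ∈ Ioo (D.pos ⊥).2 (D.pos ⊤).2 ∧ D.curves.curve (.inr false) z.2 < z.1 ∧
    z.1 < D.curves.curve (.inr true) z.2}

/-- The region between the two additional edges together with these edges. -/
def closedRegion : Set (ℝ × ℝ) :=
  {z | z.2 ∈ Icc (D.pos ⊥).2 (D.pos ⊤).2 ∧ D.curves.curve (.inr false) z.2 ≤ z.1 ∧
    z.1 ≤ D.curves.curve (.inr true) z.2}

lemma isOpen_region : IsOpen D.region :=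
  (isOpen_Ioo.preimage continuous_snd).inter
    ((isOpen_lt ((D.curves.continuous_curve _).comp continuous_snd) continuous_fst).inter
      (isOpen_lt continuous_fst ((D.curves.continuous_curve _).comp continuous_snd)))

lemma isClosed_closedRegion : IsClosed D.closedRegion :=
  (isClosed_Icc.preimage continuous_snd).inter
    ((isClosed_le ((D.curves.continuous_curve _).comp continuous_snd) continuous_fst).inter
      (isClosed_le continuous_fst ((D.curves.continuous_curve _).comp continuous_snd)))

lemma region_subset_closedRegion : D.region ⊆ D.closedRegion := fun _ hz =>
  ⟨Ioo_subset_Icc_self hz.1, hz.2.1.le, hz.2.2.le⟩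

lemma support_subset_closedRegion : D.curves.support ⊆ D.closedRegion := by
  rintro ⟨x, y⟩ ⟨i, hy, rfl : x = D.curves.curve i y⟩
  exact ⟨D.Icc_lo_hi_subset i hy, D.curves_left_le i hy, D.le_curves_right i hy⟩

lemma mem_region_of_mem_closedRegion {z : ℝ × ℝ} (hz : z ∈ D.closedRegion)
    (hs : z ∉ D.curves.support) : z ∈ D.region := by
  obtain ⟨hy, hleft, hright⟩ := hz
  replace hleft := hleft.lt_of_ne fun h => hs ⟨.inr false, hy, h.symm⟩
  replace hright := hright.lt_of_ne fun h => hs ⟨.inr true, hy, h⟩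
  have hlt := hleft.trans hright
  rw [D.curves_left hy, D.curves_right hy] at hlt
  refine ⟨⟨hy.1.lt_of_ne fun h => hlt.ne ?_, hy.2.lt_of_ne fun h => hlt.ne ?_⟩, hleft, hright⟩
  · rw [← h, D.left_bot, D.right_bot]
  · rw [h, D.left_top, D.right_top]

lemma isBounded_region : Bornology.IsBounded D.region := by
  have hcompact : ∀ b, IsCompact (D.curves.curve (.inr b) '' Icc (D.pos ⊥).2 (D.pos ⊤).2) :=
    fun b => isCompact_Icc.image (D.curves.continuous_curve _)
  obtain ⟨l, hl⟩ := (hcompact false).bddBelow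
  obtain ⟨r, hr⟩ := (hcompact true).bddAbove
  refine ((Metric.isBounded_Icc l r).prod (Metric.isBounded_Icc (D.pos ⊥).2 (D.pos ⊤).2)).subset ?_
  rintro ⟨x, y⟩ ⟨hy, hleft, hright⟩
  have hy' := Ioo_subset_Icc_self hy
  exact ⟨⟨(hl ⟨y, hy', rfl⟩).trans hleft.le, hright.le.trans (hr ⟨y, hy', rfl⟩)⟩, hy'⟩

lemma component_subset_region {z : ℝ × ℝ} (hz : z ∉ D.curves.support) (hR : z ∈ D.region) :
    D.curves.component z ⊆ D.region := by
  have hpre : IsPreconnected (D.curves.component z) := isPreconnected_connectedComponentIn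
  refine hpre.subset_left_of_subset_union D.isOpen_region D.isClosed_closedRegion.isOpen_compl
    (disjoint_compl_right_iff_subset.2 D.region_subset_closedRegion) (fun w hw => ?_)
    ⟨z, mem_connectedComponentIn hz, hR⟩
  by_cases h : w ∈ D.closedRegion
  · exact .inl (D.mem_region_of_mem_closedRegion h (connectedComponentIn_subset _ _ hw))
  · exact .inr h

lemma mem_region_of_isBounded_component {z : ℝ × ℝ} (hz : z ∉ D.curves.support)
    (hb : Bornology.IsBounded (D.curves.component z)) : z ∈ D.region := by
  refine D.mem_region_of_mem_closedRegion (by_contra fun hcl => ?_) hz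
  have hleft : ∃ t : ℝ, 0 ≤ t ∧ z + t • (-1, 0) ∈ D.curves.support := by
    by_contra! h
    exact D.curves.not_isBounded_component_of_ray (by simp) h hb
  have hright : ∃ t : ℝ, 0 ≤ t ∧ z + t • (1, 0) ∈ D.curves.support := by
    by_contra! h
    exact D.curves.not_isBounded_component_of_ray (by simp) h hb
  obtain ⟨s, hs, hsz⟩ := hleft
  obtain ⟨t, ht, htz⟩ := hright
  obtain ⟨hy, hl, -⟩ := D.support_subset_closedRegion hsz
  obtain ⟨-, -, hr⟩ := D.support_subset_closedRegion htz
  simp only [Prod.fst_add, Prod.snd_add, Prod.smul_mk, smul_eq_mul, mul_zero, add_zero] at hy hl hr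
  exact hcl ⟨hy, by linarith, by linarith⟩

lemma isFace_and_isBounded_iff {F : Set (ℝ × ℝ)} : D.IsFace F ∧ Bornology.IsBounded F ↔
    ∃ z ∈ D.region, z ∉ D.curves.support ∧ D.curves.component z = F := by
  simp only [IsFace, CurveSystem.component, D.support_curves]
  constructor
  · rintro ⟨⟨z, hz, rfl⟩, hb⟩
    rw [← D.support_curves] at hz hb
    exact ⟨z, D.mem_region_of_isBounded_component hz hb, D.support_curves ▸ hz, rfl⟩
  · rintro ⟨z, hR, hz, rfl⟩
    refine ⟨⟨z, hz, rfl⟩, ?_⟩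
    rw [← D.support_curves] at hz ⊢
    exact D.isBounded_region.subset (D.component_subset_region hz hR)

lemma mem_region_of_mem (F : D.BoundedFace) {z : ℝ × ℝ} (hz : z ∈ F.1) : z ∈ D.region := by
  obtain ⟨w, hR, hw, hF⟩ := D.isFace_and_isBounded_iff.1 F.2
  exact D.component_subset_region hw hR (hF ▸ hz)

lemma notMem_support_of_mem (F : D.BoundedFace) {z : ℝ × ℝ} (hz : z ∈ F.1) :
    z ∉ D.curves.support := by
  obtain ⟨w, -, -, hF⟩ := D.isFace_and_isBounded_iff.1 F.2
  exact connectedComponentIn_subset _ _ (hF ▸ hz)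

lemma component_eq_of_mem (F : D.BoundedFace) {z : ℝ × ℝ} (hz : z ∈ F.1) :
    D.curves.component z = F.1 := by
  obtain ⟨w, -, -, hF⟩ := D.isFace_and_isBounded_iff.1 F.2
  rw [← hF] at hz ⊢
  exact (connectedComponentIn_eq hz).symm

lemma eq_of_mem {F F' : D.BoundedFace} {z : ℝ × ℝ} (hz : z ∈ F.1) (hz' : z ∈ F'.1) : F = F' :=
  Subtype.ext ((D.component_eq_of_mem F hz).symm.trans (D.component_eq_of_mem F' hz'))

lemma isPreconnected_face (F : D.BoundedFace) : IsPreconnected F.1 := by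
  obtain ⟨w, -, -, hF⟩ := D.isFace_and_isBounded_iff.1 F.2
  exact hF ▸ isPreconnected_connectedComponentIn

lemma isFace_leftFace {i : HasseEdge P ⊕ Bool} (hi : i ≠ .inr false) :
    D.IsFace (D.curves.leftFace i) ∧ Bornology.IsBounded (D.curves.leftFace i) := by
  obtain ⟨y, hy⟩ := exists_between (D.curves.lo_lt_hi i)
  obtain ⟨x, ⟨hx, hF⟩, hxl, hxi⟩ := ((D.curves.eventually_component_eq_leftFace i hy).and
    (Ioo_mem_nhdsLT (D.curves_left_lt hi hy))).exists
  have hright := D.le_curves_right i (Ioo_subset_Icc_self hy)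
  have hR : (x, y) ∈ D.closedRegion :=
    ⟨D.Icc_lo_hi_subset i (Ioo_subset_Icc_self hy), hxl.le, hxi.le.trans hright⟩
  exact D.isFace_and_isBounded_iff.2 ⟨_, D.mem_region_of_mem_closedRegion hR hx, hx, hF⟩

lemma isFace_rightFace {i : HasseEdge P ⊕ Bool} (hi : i ≠ .inr true) :
    D.IsFace (D.curves.rightFace i) ∧ Bornology.IsBounded (D.curves.rightFace i) := by
  obtain ⟨y, hy⟩ := exists_between (D.curves.lo_lt_hi i)
  obtain ⟨x, ⟨hx, hF⟩, hix, hxr⟩ := ((D.curves.eventually_component_eq_rightFace i hy).and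
    (Ioo_mem_nhdsGT (D.lt_curves_right hi hy))).exists
  have hleft := D.curves_left_le i (Ioo_subset_Icc_self hy)
  have hR : (x, y) ∈ D.closedRegion :=
    ⟨D.Icc_lo_hi_subset i (Ioo_subset_Icc_self hy), hleft.trans hix.le, hxr.le⟩
  exact D.isFace_and_isBounded_iff.2 ⟨_, D.mem_region_of_mem_closedRegion hR hx, hx, hF⟩

/-- The bounded face on the left of an edge. -/
def leftFace (e : HasseEdge P) : D.BoundedFace :=
  ⟨D.curves.leftFace (.inl e), D.isFace_leftFace (by simp)⟩

/-- The bounded face on the right of an edge. -/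
def rightFace (e : HasseEdge P) : D.BoundedFace :=
  ⟨D.curves.rightFace (.inl e), D.isFace_rightFace (by simp)⟩

/-- The bounded face along the left additional edge; it becomes the first vertex of the truncated
dual. -/
def sourceFace : D.BoundedFace :=
  ⟨D.curves.rightFace (.inr false), D.isFace_rightFace (by simp)⟩

/-- The bounded face along the right additional edge; it becomes the last vertex of the truncated
dual. -/
def sinkFace : D.BoundedFace :=
  ⟨D.curves.leftFace (.inr true), D.isFace_leftFace (by simp)⟩

lemma isLeftFace_leftFace (e : HasseEdge P) : D.IsLeftFace (D.leftFace e).1 e := by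
  intro y hy
  rw [← D.curves_inl (Ioo_subset_Icc_self hy)]
  exact D.curves.eventually_mem_leftFace (.inl e) hy

lemma isRightFace_rightFace (e : HasseEdge P) : D.IsRightFace (D.rightFace e).1 e := by
  intro y hy
  rw [← D.curves_inl (Ioo_subset_Icc_self hy)]
  exact D.curves.eventually_mem_rightFace (.inl e) hy

lemma eq_leftFace {F : D.BoundedFace} {e : HasseEdge P} (h : D.IsLeftFace F.1 e) :
    F = D.leftFace e := by
  obtain ⟨y, hy⟩ := exists_between (D.height_lt e)
  obtain ⟨x, hx, hx'⟩ := ((h y hy).and (D.isLeftFace_leftFace e y hy)).exists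
  exact D.eq_of_mem hx hx'

lemma eq_rightFace {F : D.BoundedFace} {e : HasseEdge P} (h : D.IsRightFace F.1 e) :
    F = D.rightFace e := by
  obtain ⟨y, hy⟩ := exists_between (D.height_lt e)
  obtain ⟨x, hx, hx'⟩ := ((h y hy).and (D.isRightFace_rightFace e y hy)).exists
  exact D.eq_of_mem hx hx'

lemma exists_mem_ne_height (F : D.BoundedFace) : ∃ x y, (x, y) ∈ F.1 ∧ ∀ v, (D.pos v).2 ≠ y := by
  obtain ⟨⟨x, y₀⟩, -, hz, hF⟩ := D.isFace_and_isBounded_iff.1 F.2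
  have hopen : IsOpen F.1 := hF ▸ D.curves.isClosed_support.isOpen_compl.connectedComponentIn
  have hcont : Continuous fun y : ℝ => (x, y) := by fun_prop
  have hmem : ∀ᶠ y in 𝓝[≠] y₀, (x, y) ∈ F.1 := nhdsWithin_le_nhds
    (hcont.continuousAt.eventually (hopen.mem_nhds (hF ▸ mem_connectedComponentIn hz)))
  have hheight : ∀ᶠ y in 𝓝[≠] y₀, y ∉ range fun v => (D.pos v).2 :=
    nhdsNE_le_cofinite y₀ (finite_range _).compl_mem_cofinite
  obtain ⟨y, hy, hv⟩ := (hmem.and hheight).exists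
  exact ⟨x, y, hy, fun v h => hv ⟨v, h⟩⟩

lemma mem_Ioo_lo_hi_of_ne_height {y : ℝ} (hy : ∀ v, (D.pos v).2 ≠ y) (i : HasseEdge P ⊕ Bool)
    (hi : y ∈ Icc (D.curves.lo i) (D.curves.hi i)) :
    y ∈ Ioo (D.curves.lo i) (D.curves.hi i) := by
  rcases i with e | b
  · exact ⟨hi.1.lt_of_ne (hy e.1.1), hi.2.lt_of_ne (hy e.1.2).symm⟩
  · exact ⟨hi.1.lt_of_ne (hy ⊥), hi.2.lt_of_ne (hy ⊤).symm⟩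

lemma exists_rightFace_eq {F : D.BoundedFace} (hF : F ≠ D.sourceFace) :
    ∃ e, D.rightFace e = F := by
  obtain ⟨x, y, hm, hy⟩ := D.exists_mem_ne_height F
  have hR := D.mem_region_of_mem F hm
  obtain ⟨i, -, hix, h⟩ := D.curves.exists_component_eq_rightFace
    (D.notMem_support_of_mem F hm) (D.mem_Ioo_lo_hi_of_ne_height hy)
    ⟨.inr false, Ioo_subset_Icc_self hR.1, hR.2.1⟩
  rw [D.component_eq_of_mem F hm] at h
  rcases i with e | _ | _
  · exact ⟨e, Subtype.ext h.symm⟩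
  · exact absurd (Subtype.ext h) hF
  · exact absurd hix hR.2.2.not_gt

lemma exists_leftFace_eq {F : D.BoundedFace} (hF : F ≠ D.sinkFace) :
    ∃ e, D.leftFace e = F := by
  obtain ⟨x, y, hm, hy⟩ := D.exists_mem_ne_height F
  have hR := D.mem_region_of_mem F hm
  obtain ⟨i, -, hix, h⟩ := D.curves.exists_component_eq_leftFace
    (D.notMem_support_of_mem F hm) (D.mem_Ioo_lo_hi_of_ne_height hy)
    ⟨.inr true, Ioo_subset_Icc_self hR.1, hR.2.2⟩
  rw [D.component_eq_of_mem F hm] at h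
  rcases i with e | _ | _
  · exact ⟨e, Subtype.ext h.symm⟩
  · exact absurd hix hR.2.1.not_gt
  · exact absurd (Subtype.ext h) hF

instance instFiniteBoundedFace : Finite D.BoundedFace := by
  refine Finite.of_surjective (fun o : Option (HasseEdge P) => o.elim D.sourceFace D.rightFace) ?_
  intro F
  by_cases hF : F = D.sourceFace
  · exact ⟨none, hF.symm⟩
  · obtain ⟨e, he⟩ := D.exists_rightFace_eq hF
    exact ⟨some e, he⟩

end AugmentedDrawing

/-! ### Jumps across the edges -/

namespace AugmentedDrawing

variable {P : Type*} [PartialOrder P]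

/-- The lower end of an edge of the augmented diagram, with the indexing of `curves`. -/
def lowerEnd : HasseEdge P ⊕ Bool → PosetHat P := Sum.elim (fun e => e.1.1) fun _ => ⊥

/-- The upper end of an edge of the augmented diagram, with the indexing of `curves`. -/
def upperEnd : HasseEdge P ⊕ Bool → PosetHat P := Sum.elim (fun e => e.1.2) fun _ => ⊤

lemma lowerEnd_lt_upperEnd (i : HasseEdge P ⊕ Bool) : lowerEnd i < upperEnd i := by
  rcases i with e | _
  · exact e.2.lt
  · exact bot_lt_top

variable [Finite P] (D : AugmentedDrawing P)

lemma lo_curves (i : HasseEdge P ⊕ Bool) : D.curves.lo i = (D.pos (lowerEnd i)).2 := by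
  cases i <;> rfl

lemma hi_curves (i : HasseEdge P ⊕ Bool) : D.curves.hi i = (D.pos (upperEnd i)).2 := by
  cases i <;> rfl

lemma pos_lowerEnd_mem_trace (i : HasseEdge P ⊕ Bool) :
    D.pos (lowerEnd i) ∈ D.curves.trace i := by
  refine ⟨by rw [← lo_curves]; exact left_mem_Icc.2 (D.curves.lo_lt_hi i).le, ?_⟩
  have hbot := left_mem_Icc.2 D.height_bot_lt_height_top.le
  rcases i with e | _ | _
  · exact ((D.curves_inl (left_mem_Icc.2 (D.height_lt e).le)).trans (D.curve_lower e)).symm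
  · exact ((D.curves_left hbot).trans D.left_bot).symm
  · exact ((D.curves_right hbot).trans D.right_bot).symm

lemma pos_upperEnd_mem_trace (i : HasseEdge P ⊕ Bool) :
    D.pos (upperEnd i) ∈ D.curves.trace i := by
  refine ⟨by rw [← hi_curves]; exact right_mem_Icc.2 (D.curves.lo_lt_hi i).le, ?_⟩
  have htop := right_mem_Icc.2 D.height_bot_lt_height_top.le
  rcases i with e | _ | _
  · exact ((D.curves_inl (right_mem_Icc.2 (D.height_lt e).le)).trans (D.curve_upper e)).symm
  · exact ((D.curves_left htop).trans D.left_top).symm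
  · exact ((D.curves_right htop).trans D.right_top).symm

lemma pos_mem_region {v : PosetHat P} (hbot : v ≠ ⊥) (htop : v ≠ ⊤) : D.pos v ∈ D.region := by
  have hv : (D.pos v).2 ∈ Ioo (D.pos ⊥).2 (D.pos ⊤).2 :=
    ⟨D.bot_lt_height hbot, D.height_lt_top htop⟩
  obtain ⟨w, hw, -⟩ := exists_covBy_le_of_lt (lt_top_iff_ne_top.2 htop)
  let e : HasseEdge P := ⟨(v, w), hw⟩
  have he : (D.pos v).2 ∈ Icc (D.pos e.1.1).2 (D.pos e.1.2).2 := ⟨le_rfl, (D.height_lt e).le⟩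
  have hcurve : D.curve e (D.pos v).2 = (D.pos v).1 := D.curve_lower e
  have hIcc := Ioo_subset_Icc_self hv
  refine ⟨hv, ?_, ?_⟩
  · rw [D.curves_left hIcc, ← hcurve]
    exact D.left_lt _ hv e he
  · rw [D.curves_right hIcc, ← hcurve]
    exact D.lt_right _ hv e he

lemma pos_mem_trace_iff {v : PosetHat P} {i : HasseEdge P ⊕ Bool} :
    D.pos v ∈ D.curves.trace i ↔ v = lowerEnd i ∨ v = upperEnd i := by
  refine ⟨fun ⟨hy, hx⟩ => ?_, ?_⟩
  · rcases i with e | b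
    · exact D.vertex_on_curve e v hy (hx.trans (D.curves_inl hy)).symm
    · by_contra! hv
      obtain ⟨-, hleft, hright⟩ := D.pos_mem_region hv.1 hv.2
      cases b
      · exact hleft.ne' hx
      · exact hright.ne hx
  · rintro (rfl | rfl)
    · exact D.pos_lowerEnd_mem_trace i
    · exact D.pos_upperEnd_mem_trace i

open Classical in
lemma netInflow_curves_jump {M : Type*} [AddCommGroup M] (g : Set (ℝ × ℝ) → M) (v : PosetHat P) :
    netInflow lowerEnd upperEnd (D.curves.jump g) v = 0 := by
  refine sub_eq_zero.2 (D.curves.sum_jump_eq_sum_jump g (D.pos v) _ _ (fun i => ?_) (fun i => ?_)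
    fun i hi => ?_)
  · rw [Finset.mem_filter_univ, hi_curves, pos_mem_trace_iff]
    refine ⟨fun h => ⟨by rw [h], .inr h.symm⟩, fun ⟨h, hv⟩ => (hv.resolve_left ?_).symm⟩
    rintro rfl
    exact (D.height_strictMono (lowerEnd_lt_upperEnd i)).ne' h
  · rw [Finset.mem_filter_univ, lo_curves, pos_mem_trace_iff]
    refine ⟨fun h => ⟨by rw [h], .inl h.symm⟩, fun ⟨h, hv⟩ => (hv.resolve_right ?_).symm⟩
    rintro rfl
    exact (D.height_strictMono (lowerEnd_lt_upperEnd i)).ne h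
  · rw [hi_curves, lo_curves]
    rcases D.pos_mem_trace_iff.1 hi with rfl | rfl
    · exact .inr rfl
    · exact .inl rfl

lemma not_isBounded_leftFace_left :
    ¬ (D.IsFace (D.curves.leftFace (.inr false)) ∧
      Bornology.IsBounded (D.curves.leftFace (.inr false))) := by
  intro h
  obtain ⟨y, hy⟩ := exists_between (D.curves.lo_lt_hi (.inr false))
  obtain ⟨x, hx, hlt⟩ :=
    ((D.curves.eventually_mem_leftFace _ hy).and self_mem_nhdsWithin).exists
  exact (D.mem_region_of_mem ⟨_, h⟩ hx).2.1.not_gt hlt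

lemma not_isBounded_rightFace_right :
    ¬ (D.IsFace (D.curves.rightFace (.inr true)) ∧
      Bornology.IsBounded (D.curves.rightFace (.inr true))) := by
  intro h
  obtain ⟨y, hy⟩ := exists_between (D.curves.lo_lt_hi (.inr true))
  obtain ⟨x, hx, hlt⟩ :=
    ((D.curves.eventually_mem_rightFace _ hy).and self_mem_nhdsWithin).exists
  exact (D.mem_region_of_mem ⟨_, h⟩ hx).2.2.not_gt hlt

/-- The jump across an edge, from left to right, of a function of the bounded faces. -/
def jump {M : Type*} [AddCommGroup M] (g : D.BoundedFace → M) (e : HasseEdge P) : M :=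
  g (D.rightFace e) - g (D.leftFace e)

/-- Extending `g` by `0` to the unbounded face gives a flow that is conserved at every vertex of
the augmented diagram; the two additional edges carry `g sourceFace` and `-g sinkFace`. -/
theorem sum_jump_mul_sub {R : Type*} [Ring R] (g : D.BoundedFace → R) (f : PosetHat P → R) :
    ∑ e : HasseEdge P, D.jump g e * (f e.1.2 - f e.1.1) =
      (g D.sinkFace - g D.sourceFace) * (f ⊤ - f ⊥) := by
  classical
  have : Fintype (PosetHat P) := Fintype.ofFinite _
  let g' : Set (ℝ × ℝ) → R := Function.extend (fun F : D.BoundedFace => F.1) g 0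
  have hg' (F : D.BoundedFace) : g' F.1 = g F := Subtype.val_injective.extend_apply g 0 F
  have hinl (e) : D.curves.jump g' (.inl e) = D.jump g e :=
    congrArg₂ (· - ·) (hg' (D.rightFace e)) (hg' (D.leftFace e))
  have hunbounded {F : Set (ℝ × ℝ)} (hF : ¬ (D.IsFace F ∧ Bornology.IsBounded F)) : g' F = 0 :=
    Function.extend_apply' _ _ _ fun ⟨F', h⟩ => hF (h ▸ F'.2)
  have hleft : D.curves.jump g' (.inr false) = g D.sourceFace :=
    (congrArg₂ (· - ·) (hg' D.sourceFace) (hunbounded D.not_isBounded_leftFace_left)).trans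
      (sub_zero _)
  have hright : D.curves.jump g' (.inr true) = -g D.sinkFace :=
    (congrArg₂ (· - ·) (hunbounded D.not_isBounded_rightFace_right) (hg' D.sinkFace)).trans
      (zero_sub _)
  have hsum := sum_mul_sub_eq_sum_netInflow_mul lowerEnd upperEnd (D.curves.jump g') f
  simp only [netInflow_curves_jump, zero_mul, Finset.sum_const_zero, Fintype.sum_sum_type,
    Fintype.sum_bool, hinl, hleft, hright] at hsum
  refine (eq_neg_of_add_eq_zero_left hsum).trans ?_
  simp only [upperEnd, lowerEnd, Sum.elim_inr, neg_mul, neg_add, neg_neg, sub_eq_add_neg,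
    add_mul]

end AugmentedDrawing

/-! ### Maximal chains -/

namespace AugmentedDrawing

variable {P : Type*} [PartialOrder P] (D : AugmentedDrawing P)

/-- The edges in `S` form a saturated chain from `a` to `b`, drawn along the curve `γ`. -/
structure IsChainCurve (a b : PosetHat P) (S : Finset (HasseEdge P)) (γ : ℝ → ℝ) : Prop where
  le : a ≤ b
  continuous : Continuous γ
  lower : γ (D.pos a).2 = (D.pos a).1
  upper : γ (D.pos b).2 = (D.pos b).1
  le_lower : ∀ e ∈ S, a ≤ e.1.1
  upper_le : ∀ e ∈ S, e.1.2 ≤ b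
  eqOn : ∀ e ∈ S, EqOn γ (D.curve e) (Icc (D.pos e.1.1).2 (D.pos e.1.2).2)
  cover : ∀ y ∈ Ico (D.pos a).2 (D.pos b).2,
    ∃ e ∈ S, y ∈ Ico (D.pos e.1.1).2 (D.pos e.1.2).2

/-- The indicator of the bounded faces to the right of the curve `γ`. -/
def side (γ : ℝ → ℝ) (F : D.BoundedFace) : ℝ :=
  open Classical in if ∃ z ∈ F.1, γ z.2 < z.1 then 1 else 0

namespace IsChainCurve

variable {D} {a b c : PosetHat P} {S S' : Finset (HasseEdge P)} {γ γ' : ℝ → ℝ}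

lemma refl (a : PosetHat P) : D.IsChainCurve a a ∅ fun _ => (D.pos a).1 :=
  ⟨le_rfl, continuous_const, rfl, rfl, by simp, by simp, by simp, by simp⟩

open Classical in
lemma append (h : D.IsChainCurve a b S γ) (h' : D.IsChainCurve b c S' γ') :
    D.IsChainCurve a c (S ∪ S') fun y => if y ≤ (D.pos b).2 then γ y else γ' y where
  le := h.le.trans h'.le
  continuous := Continuous.if_le h.continuous h'.continuous continuous_id continuous_const
    (by rintro y (rfl : y = _); rw [h.upper, h'.lower])
  lower := by rw [if_pos (D.height_strictMono.monotone h.le), h.lower]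
  upper := by
    rcases (D.height_strictMono.monotone h'.le).eq_or_lt with hbc | hbc
    · rw [if_pos hbc.ge, ← hbc, h.upper, ← h'.lower, hbc, h'.upper]
    · rw [if_neg hbc.not_ge, h'.upper]
  le_lower e he :=
    (Finset.mem_union.1 he).elim (h.le_lower e) fun he => h.le.trans (h'.le_lower e he)
  upper_le e he :=
    (Finset.mem_union.1 he).elim (fun he => (h.upper_le e he).trans h'.le) (h'.upper_le e)
  eqOn e he y hy := by
    beta_reduce
    rcases Finset.mem_union.1 he with he | he
    · rw [if_pos (hy.2.trans (D.height_strictMono.monotone (h.upper_le e he))), h.eqOn e he hy]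
    · rcases ((D.height_strictMono.monotone (h'.le_lower e he)).trans hy.1).eq_or_lt with hb | hb
      · rw [if_pos hb.ge, ← h'.eqOn e he hy, ← hb, h.upper, h'.lower]
      · rw [if_neg hb.not_ge, h'.eqOn e he hy]
  cover y hy := by
    rcases lt_or_ge y (D.pos b).2 with hyb | hyb
    · obtain ⟨e, he, hye⟩ := h.cover y ⟨hy.1, hyb⟩
      exact ⟨e, Finset.mem_union_left _ he, hye⟩
    · obtain ⟨e, he, hye⟩ := h'.cover y ⟨hyb, hy.2⟩
      exact ⟨e, Finset.mem_union_right _ he, hye⟩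

lemma disjoint (h : D.IsChainCurve a b S γ) (h' : D.IsChainCurve b c S' γ') : Disjoint S S' :=
  Finset.disjoint_left.2 fun e he he' =>
    ((h.upper_le e he).trans (h'.le_lower e he')).not_gt e.2.lt

lemma eq_empty (h : D.IsChainCurve a a S γ) : S = ∅ :=
  Finset.eq_empty_of_forall_notMem fun e he =>
    ((h.upper_le e he).trans (h.le_lower e he)).not_gt e.2.lt

lemma exists_mem_curve_eq (h : D.IsChainCurve ⊥ ⊤ S γ) {y : ℝ}
    (hy : y ∈ Ioo (D.pos ⊥).2 (D.pos ⊤).2) :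
    ∃ e ∈ S, y ∈ Icc (D.pos e.1.1).2 (D.pos e.1.2).2 ∧ γ y = D.curve e y := by
  obtain ⟨e, he, hye⟩ := h.cover y (Ioo_subset_Ico_self hy)
  exact ⟨e, he, Ico_subset_Icc_self hye, h.eqOn e he (Ico_subset_Icc_self hye)⟩

lemma side_eq_one {F : D.BoundedFace} {x y : ℝ} (hz : (x, y) ∈ F.1) (hγ : γ y < x) :
    D.side γ F = 1 :=
  if_pos ⟨_, hz, hγ⟩

variable [Finite P]

lemma edge (e : HasseEdge P) : D.IsChainCurve e.1.1 e.1.2 {e} (D.curves.curve (.inl e)) where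
  le := e.2.le
  continuous := D.curves.continuous_curve _
  lower := by rw [D.curves_inl ⟨le_rfl, (D.height_lt e).le⟩, D.curve_lower]
  upper := by rw [D.curves_inl ⟨(D.height_lt e).le, le_rfl⟩, D.curve_upper]
  le_lower := by simp
  upper_le := by simp
  eqOn _ he _ hy := by
    obtain rfl := Finset.mem_singleton.1 he
    exact D.curves_inl hy
  cover _ hy := ⟨e, Finset.mem_singleton_self e, hy⟩

lemma ne_of_mem (h : D.IsChainCurve ⊥ ⊤ S γ) (F : D.BoundedFace) {z : ℝ × ℝ} (hz : z ∈ F.1) :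
    γ z.2 ≠ z.1 := by
  intro hγ
  obtain ⟨e, -, hye, hγe⟩ := h.exists_mem_curve_eq (D.mem_region_of_mem F hz).1
  exact D.notMem_support_of_mem F hz
    ⟨.inl e, hye, hγ.symm.trans (hγe.trans (D.curves_inl hye).symm)⟩

lemma lt_of_mem_of_lt (h : D.IsChainCurve ⊥ ⊤ S γ) {F : D.BoundedFace} {z w : ℝ × ℝ}
    (hz : z ∈ F.1) (hzγ : γ z.2 < z.1) (hw : w ∈ F.1) : γ w.2 < w.1 := by
  have hγ := h.continuous
  have hright : IsOpen {z : ℝ × ℝ | γ z.2 < z.1} := isOpen_lt (by fun_prop) continuous_fst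
  have hleft : IsOpen {z : ℝ × ℝ | z.1 < γ z.2} := isOpen_lt continuous_fst (by fun_prop)
  have hdisj : Disjoint {z : ℝ × ℝ | γ z.2 < z.1} {z | z.1 < γ z.2} :=
    Set.disjoint_left.2 fun _ => lt_asymm (α := ℝ)
  refine (D.isPreconnected_face F).subset_left_of_subset_union hright hleft hdisj
    (fun z hz => ?_) ⟨z, hz, hzγ⟩ hw
  exact lt_or_gt_of_ne (h.ne_of_mem F hz)

lemma side_eq_zero (h : D.IsChainCurve ⊥ ⊤ S γ) {F : D.BoundedFace} {x y : ℝ}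
    (hz : (x, y) ∈ F.1) (hγ : x < γ y) : D.side γ F = 0 :=
  if_neg fun ⟨_, hw, hwγ⟩ => hγ.not_gt (h.lt_of_mem_of_lt hw hwγ hz)

lemma side_sourceFace (h : D.IsChainCurve ⊥ ⊤ S γ) : D.side γ D.sourceFace = 0 := by
  obtain ⟨y, hy⟩ := exists_between D.height_bot_lt_height_top
  obtain ⟨e, -, hye, hγ⟩ := h.exists_mem_curve_eq hy
  have hlt : D.curves.curve (.inr false) y < γ y := by
    rw [D.curves_left (Ioo_subset_Icc_self hy), hγ]
    exact D.left_lt y hy e hye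
  obtain ⟨x, hx, -, hxγ⟩ :=
    ((D.curves.eventually_mem_rightFace (.inr false) hy).and (Ioo_mem_nhdsGT hlt)).exists
  exact h.side_eq_zero hx hxγ

lemma side_sinkFace (h : D.IsChainCurve ⊥ ⊤ S γ) : D.side γ D.sinkFace = 1 := by
  obtain ⟨y, hy⟩ := exists_between D.height_bot_lt_height_top
  obtain ⟨e, -, hye, hγ⟩ := h.exists_mem_curve_eq hy
  have hlt : γ y < D.curves.curve (.inr true) y := by
    rw [D.curves_right (Ioo_subset_Icc_self hy), hγ]
    exact D.lt_right y hy e hye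
  obtain ⟨x, hx, hxγ, -⟩ :=
    ((D.curves.eventually_mem_leftFace (.inr true) hy).and (Ioo_mem_nhdsLT hlt)).exists
  exact side_eq_one hx hxγ

lemma jump_side_of_mem (h : D.IsChainCurve ⊥ ⊤ S γ) {e : HasseEdge P} (he : e ∈ S) :
    D.jump (D.side γ) e = 1 := by
  obtain ⟨y, hy⟩ := exists_between (D.height_lt e)
  have hγ := h.eqOn e he (Ioo_subset_Icc_self hy)
  obtain ⟨l, hl, hlγ⟩ := ((D.isLeftFace_leftFace e y hy).and self_mem_nhdsWithin).exists
  obtain ⟨r, hr, hrγ⟩ := ((D.isRightFace_rightFace e y hy).and self_mem_nhdsWithin).exists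
  rw [jump, side_eq_one hr (hγ.trans_lt hrγ), h.side_eq_zero hl (hlγ.trans_eq hγ.symm), sub_zero]

lemma jump_side_of_notMem (h : D.IsChainCurve ⊥ ⊤ S γ) {e : HasseEdge P} (he : e ∉ S) :
    D.jump (D.side γ) e = 0 := by
  obtain ⟨y, hy⟩ := exists_between (D.height_lt e)
  obtain ⟨e', he', hye', hγ⟩ := h.exists_mem_curve_eq (D.mem_Ioo_bot_top hy)
  have hleft := D.isLeftFace_leftFace e y hy
  have hright := D.isRightFace_rightFace e y hy
  have hne : D.curve e y ≠ γ y :=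
    hγ ▸ D.curve_ne_of_ne (ne_of_mem_of_not_mem he' he).symm hy hye'
  rw [jump, sub_eq_zero]
  rcases hne.lt_or_gt with hlt | hgt
  · obtain ⟨l, hl, hlγ⟩ := (hleft.and (nhdsWithin_le_nhds (Iio_mem_nhds hlt))).exists
    obtain ⟨r, hr, hrγ⟩ := (hright.and (nhdsWithin_le_nhds (Iio_mem_nhds hlt))).exists
    rw [h.side_eq_zero hr hrγ, h.side_eq_zero hl hlγ]
  · obtain ⟨l, hl, hlγ⟩ := (hleft.and (nhdsWithin_le_nhds (Ioi_mem_nhds hgt))).exists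
    obtain ⟨r, hr, hrγ⟩ := (hright.and (nhdsWithin_le_nhds (Ioi_mem_nhds hgt))).exists
    rw [side_eq_one hr hrγ, side_eq_one hl hlγ]

open Classical in
lemma jump_side (h : D.IsChainCurve ⊥ ⊤ S γ) (e : HasseEdge P) :
    D.jump (D.side γ) e = if e ∈ S then 1 else 0 := by
  split_ifs with he
  · exact h.jump_side_of_mem he
  · exact h.jump_side_of_notMem he

end IsChainCurve

variable [Finite P]

lemma exists_isChainCurve {a b : PosetHat P} (hab : a ≤ b) : ∃ S γ, D.IsChainCurve a b S γ := by
  induction b using WellFoundedLT.induction with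
  | ind b ih =>
    rcases hab.eq_or_lt with rfl | hab
    · exact ⟨_, _, .refl a⟩
    · obtain ⟨c, hac, hcb⟩ := exists_le_covBy_of_lt hab
      obtain ⟨S, γ, h⟩ := ih c hcb.lt hac
      exact ⟨_, _, h.append (.edge ⟨(c, b), hcb⟩)⟩

lemma exists_isChainCurve_mem (e : HasseEdge P) : ∃ S γ, D.IsChainCurve ⊥ ⊤ S γ ∧ e ∈ S := by
  classical
  obtain ⟨S, γ, h⟩ := D.exists_isChainCurve (bot_le (a := e.1.1))
  obtain ⟨S', γ', h'⟩ := D.exists_isChainCurve (le_top (a := e.1.2))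
  exact ⟨_, _, (h.append (.edge e)).append h', by simp⟩

lemma sourceFace_ne_sinkFace : D.sourceFace ≠ D.sinkFace := by
  obtain ⟨S, γ, h⟩ := D.exists_isChainCurve bot_le
  intro heq
  exact zero_ne_one (h.side_sourceFace.symm.trans (heq ▸ h.side_sinkFace))

/-! ### The truncated dual as an ordered graph -/

/-- The number of chains to the left of a face, in a family of maximal chains that covers all edges,
increases along every dual edge. -/
lemma exists_potential : ∃ w : D.BoundedFace → ℝ, ∀ e, w (D.leftFace e) < w (D.rightFace e) := by
  classical
  choose S γ h hS using D.exists_isChainCurve_mem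
  refine ⟨fun F => ∑ e, D.side (γ e) F, fun e => ?_⟩
  have hjump (e') : D.side (γ e') (D.rightFace e) - D.side (γ e') (D.leftFace e) = _ :=
    (h e').jump_side e
  rw [← sub_pos, ← Finset.sum_sub_distrib]
  simp only [hjump]
  exact Finset.sum_pos' (fun _ _ => by positivity) ⟨e, Finset.mem_univ _, by simp [hS e]⟩

lemma exists_equiv_fin : ∃ (k : ℕ) (φ : Fin k ≃ D.BoundedFace),
    ∀ e, φ.symm (D.leftFace e) < φ.symm (D.rightFace e) := by
  obtain ⟨w, hw⟩ := D.exists_potential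
  let ψ := (Finite.equivFin D.BoundedFace).symm
  refine ⟨_, (Tuple.sort (w ∘ ψ)).trans ψ, fun e => ?_⟩
  by_contra! h
  have hle := Tuple.monotone_sort (w ∘ ψ) h
  simp only [Function.comp, Equiv.symm_trans_apply, Equiv.apply_symm_apply] at hle
  exact (hw e).not_ge hle

/-- The truncated dual with a given numbering of its vertices. -/
def dualGraph {k : ℕ} (φ : Fin k ≃ D.BoundedFace)
    (hφ : ∀ e, φ.symm (D.leftFace e) < φ.symm (D.rightFace e)) :
    OrderedGraph k (HasseEdge P) where
  tail e := φ.symm (D.leftFace e)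
  head e := φ.symm (D.rightFace e)
  tail_lt_head := hφ
  connected := by
    refine (SimpleGraph.connected_iff_exists_forall_reachable _).2
      ⟨φ.symm D.sourceFace, fun v => ?_⟩
    induction v using WellFoundedLT.induction with
    | ind v ih =>
      by_cases hv : φ v = D.sourceFace
      · rw [← hv, Equiv.symm_apply_apply]
      · obtain ⟨e, he⟩ := D.exists_rightFace_eq hv
        have hhead : φ.symm (D.rightFace e) = v := by rw [he, Equiv.symm_apply_apply]
        have hlt := hhead ▸ hφ e
        refine (ih _ hlt).trans (SimpleGraph.Adj.reachable ?_)
        exact (SimpleGraph.fromRel_adj _ _ _).2 ⟨hlt.ne, .inl ⟨e, rfl, hhead⟩⟩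

theorem exists_isTruncatedDual :
    ∃ (k : ℕ) (G : OrderedGraph k (HasseEdge P)), IsTruncatedDual D G := by
  obtain ⟨k, φ, hφ⟩ := D.exists_equiv_fin
  refine ⟨k, D.dualGraph φ hφ, φ, fun e => ?_⟩
  simp only [dualGraph, Equiv.apply_symm_apply]
  exact ⟨D.isLeftFace_leftFace e, D.isRightFace_rightFace e⟩

variable {D} {k : ℕ} {G : OrderedGraph k (HasseEdge P)} {φ : Fin k ≃ D.BoundedFace}

lemma apply_eq_sourceFace (hhead : ∀ e, φ (G.head e) = D.rightFace e) {v : Fin k}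
    (hv : (v : ℕ) = 0) : φ v = D.sourceFace := by
  by_contra hne
  obtain ⟨e, he⟩ := D.exists_rightFace_eq hne
  have hlt := G.tail_lt_head e
  rw [φ.injective ((hhead e).trans he), Fin.lt_def] at hlt
  omega

lemma apply_eq_sinkFace (htail : ∀ e, φ (G.tail e) = D.leftFace e) {v : Fin k}
    (hv : (v : ℕ) + 1 = k) : φ v = D.sinkFace := by
  by_contra hne
  obtain ⟨e, he⟩ := D.exists_leftFace_eq hne
  have hlt := G.tail_lt_head e
  rw [φ.injective ((htail e).trans he), Fin.lt_def] at hlt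
  omega

end AugmentedDrawing

/-! ### Order polytopes -/

/-- Stanley's order polytope of a bounded poset `Q`. The values at `⊥` and `⊤` are fixed, so that
for `Q = PosetHat P` it consists of the order-preserving functions `P → [0, 1]`, extended by `0`
and `1`. -/
def orderPolytope (Q : Type*) [Preorder Q] [BoundedOrder Q] : Set (Q → ℝ) :=
  {f | f ⊥ = 0 ∧ f ⊤ = 1 ∧ Monotone f}

/-- The differences of a function along the edges of the Hasse diagram. -/
def coverDifference (P : Type*) [PartialOrder P] : (PosetHat P → ℝ) →ₗ[ℝ] (HasseEdge P → ℝ) :=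
  LinearMap.pi fun e => (LinearMap.proj e.1.2 : (PosetHat P → ℝ) →ₗ[ℝ] ℝ) - LinearMap.proj e.1.1

lemma coverDifference_apply {P : Type*} [PartialOrder P] (f : PosetHat P → ℝ) (e : HasseEdge P) :
    coverDifference P f e = f e.1.2 - f e.1.1 := rfl

/-! ### Flows on the truncated dual -/

lemma mem_flowPolytope_iff_netInflow {k : ℕ} {E : Type*} [Fintype E] {G : OrderedGraph k E}
    {a b : Fin k} (ha : (a : ℕ) = 0) (hb : (b : ℕ) + 1 = k) {fl : E → ℝ} :
    fl ∈ flowPolytope G ↔ (∀ e, 0 ≤ fl e) ∧ netInflow G.tail G.head fl a = -1 ∧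
      netInflow G.tail G.head fl b = 1 ∧
      ∀ v, v ≠ a → v ≠ b → netInflow G.tail G.head fl v = 0 := by
  have htail : ∀ e, (G.tail e : ℕ) = 0 ↔ G.tail e = a := fun e => by rw [Fin.ext_iff, ha]
  have hhead : ∀ e, (G.head e : ℕ) + 1 = k ↔ G.head e = b := fun e => by rw [Fin.ext_iff]; omega
  have hina : ∀ e, G.head e ≠ a := fun e h => by
    have := Fin.lt_def.1 (G.tail_lt_head e)
    rw [h] at this
    omega
  have houtb : ∀ e, G.tail e ≠ b := fun e h => by
    have := Fin.lt_def.1 (G.tail_lt_head e)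
    rw [h] at this
    omega
  simp only [flowPolytope, mem_ofPred_eq, netInflow, htail, hhead, hina, houtb, Finset.filter_false,
    Finset.sum_empty, zero_sub, sub_zero, neg_inj, sub_eq_zero]
  have hinner : ∀ v : Fin k, (v ≠ a ↔ 0 < (v : ℕ)) ∧ (v ≠ b ↔ (v : ℕ) + 1 < k) := fun v => by
    simp only [ne_eq, Fin.ext_iff]
    omega
  simp only [hinner]

namespace AugmentedDrawing

variable {P : Type*} [PartialOrder P] [Finite P] {D : AugmentedDrawing P}

open Classical in
lemma mem_flowPolytope_iff_netInflow_face {k : ℕ} {G : OrderedGraph k (HasseEdge P)}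
    (hG : IsTruncatedDual D G) {fl : HasseEdge P → ℝ} :
    fl ∈ flowPolytope G ↔ (∀ e, 0 ≤ fl e) ∧
      netInflow D.leftFace D.rightFace fl D.sourceFace = -1 ∧
      netInflow D.leftFace D.rightFace fl D.sinkFace = 1 ∧
      ∀ F, F ≠ D.sourceFace → F ≠ D.sinkFace → netInflow D.leftFace D.rightFace fl F = 0 := by
  obtain ⟨φ, hφ⟩ := hG
  have htail : ∀ e, φ (G.tail e) = D.leftFace e := fun e => D.eq_leftFace (hφ e).1
  have hhead : ∀ e, φ (G.head e) = D.rightFace e := fun e => D.eq_rightFace (hφ e).2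
  have hk := (φ.symm D.sourceFace).pos
  let a : Fin k := ⟨0, hk⟩
  let b : Fin k := ⟨k - 1, by omega⟩
  have ha : φ a = D.sourceFace := apply_eq_sourceFace hhead rfl
  have hb : φ b = D.sinkFace := apply_eq_sinkFace htail (Nat.sub_add_cancel hk)
  have hnet : ∀ v, netInflow G.tail G.head fl v =
      netInflow D.leftFace D.rightFace fl (φ v) := fun v => by
    simp only [netInflow, ← htail, ← hhead, φ.apply_eq_iff_eq]
  rw [mem_flowPolytope_iff_netInflow (a := a) (b := b) rfl (Nat.sub_add_cancel hk)]
  simp only [hnet, ← ha, ← hb, φ.surjective.forall, φ.injective.ne_iff]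

open Classical in
lemma sum_eq_one_of_netInflow {fl : HasseEdge P → ℝ}
    (hsource : netInflow D.leftFace D.rightFace fl D.sourceFace = -1)
    (hinner : ∀ F, F ≠ D.sourceFace → F ≠ D.sinkFace →
      netInflow D.leftFace D.rightFace fl F = 0)
    {S : Finset (HasseEdge P)} {γ : ℝ → ℝ} (h : D.IsChainCurve ⊥ ⊤ S γ) :
    ∑ e ∈ S, fl e = 1 := by
  have hsum := sum_mul_sub_of_netInflow_eq_zero D.sourceFace_ne_sinkFace hinner (D.side γ)
  have hjump (e) : D.side γ (D.rightFace e) - D.side γ (D.leftFace e) = _ := h.jump_side e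
  simpa only [hjump, hsource, h.side_sourceFace, h.side_sinkFace, mul_ite, mul_one, mul_zero,
    Finset.sum_ite_mem, Finset.univ_inter, neg_neg, sub_zero] using hsum

/-- The potential of an element is the sum along any chain from `⊥` up to it. -/
lemma mem_image_coverDifference_of_sum_chain_eq_one {fl : HasseEdge P → ℝ} (hpos : ∀ e, 0 ≤ fl e)
    (hsum : ∀ S γ, D.IsChainCurve ⊥ ⊤ S γ → ∑ e ∈ S, fl e = 1) :
    fl ∈ coverDifference P '' orderPolytope (PosetHat P) := by
  classical
  choose S γ hS using fun p : PosetHat P => D.exists_isChainCurve (bot_le (a := p))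
  have hstep : ∀ {a b T δ}, D.IsChainCurve a b T δ →
      ∑ e ∈ S b, fl e - ∑ e ∈ S a, fl e = ∑ e ∈ T, fl e := by
    intro a b T δ hT
    obtain ⟨U, ε, hU⟩ := D.exists_isChainCurve (le_top (a := b))
    have hthrough := hsum _ _ (((hS a).append hT).append hU)
    have hdirect := hsum _ _ ((hS b).append hU)
    rw [Finset.sum_union (((hS a).append hT).disjoint hU),
      Finset.sum_union ((hS a).disjoint hT)] at hthrough
    rw [Finset.sum_union ((hS b).disjoint hU)] at hdirect
    linarith
  refine ⟨fun p => ∑ e ∈ S p, fl e, ⟨?_, hsum _ _ (hS ⊤), fun a b hab => ?_⟩, ?_⟩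
  · simp only [(hS ⊥).eq_empty, Finset.sum_empty]
  · obtain ⟨T, δ, hT⟩ := D.exists_isChainCurve hab
    exact sub_nonneg.1 ((hstep hT).symm ▸ Finset.sum_nonneg fun e _ => hpos e)
  · funext e
    exact (hstep (.edge e)).trans (Finset.sum_singleton _ _)

open Classical in
lemma netInflow_coverDifference (f : PosetHat P → ℝ) (F : D.BoundedFace) :
    netInflow D.leftFace D.rightFace (coverDifference P f) F =
      ((Pi.single F 1 : D.BoundedFace → ℝ) D.sinkFace -
        (Pi.single F 1 : D.BoundedFace → ℝ) D.sourceFace) * (f ⊤ - f ⊥) := by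
  have : Fintype D.BoundedFace := Fintype.ofFinite _
  have hdual := sum_mul_sub_eq_sum_netInflow_mul D.leftFace D.rightFace
    (coverDifference P f) (Pi.single F 1)
  simp only [Pi.single_apply, mul_ite, mul_one, mul_zero, Finset.sum_ite_eq', Finset.mem_univ,
    if_true] at hdual
  rw [← hdual, ← sum_jump_mul_sub]
  simp only [coverDifference_apply, jump, Pi.single_apply, mul_comm]

theorem flowPolytope_eq_image {k : ℕ} {G : OrderedGraph k (HasseEdge P)}
    (hG : IsTruncatedDual D G) :
    flowPolytope G = coverDifference P '' orderPolytope (PosetHat P) := by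
  classical
  ext fl
  rw [mem_flowPolytope_iff_netInflow_face hG]
  constructor
  · rintro ⟨hpos, hsource, -, hinner⟩
    exact mem_image_coverDifference_of_sum_chain_eq_one hpos fun S γ =>
      sum_eq_one_of_netInflow hsource hinner
  · rintro ⟨f, ⟨hbot, htop, hf⟩, rfl⟩
    have hne := D.sourceFace_ne_sinkFace
    simp only [netInflow_coverDifference, hbot, htop, sub_zero, mul_one, Pi.single_apply]
    refine ⟨fun e => sub_nonneg.2 (hf e.2.le), ?_, ?_, fun F hsource hsink => ?_⟩
    · simp [hne.symm]
    · simp [hne]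
    · simp [hsource.symm, hsink.symm]

end AugmentedDrawing

/-! ### Integral equivalence -/

lemma IntegrallyEquivalent.trans {ι κ τ : Type*} {P : Set (ι → ℝ)} {Q : Set (κ → ℝ)}
    {R : Set (τ → ℝ)} (hPQ : IntegrallyEquivalent P Q) (hQR : IntegrallyEquivalent Q R) :
    IntegrallyEquivalent P R := by
  obtain ⟨f, hf, hfint⟩ := hPQ
  obtain ⟨g, hg, hgint⟩ := hQR
  exact ⟨g.comp f, hg.comp hf, hgint.comp hfint⟩

lemma integrallyEquivalent_image {ι κ : Type*} {P : Set (ι → ℝ)} (f : (ι → ℝ) →ᵃ[ℝ] (κ → ℝ))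
    (hinj : InjOn f (affineSpan ℝ P : Set (ι → ℝ)))
    (hint : ∀ x ∈ affineSpan ℝ P, f x ∈ integerPoints κ ↔ x ∈ integerPoints ι) :
    IntegrallyEquivalent P (f '' P) := by
  refine ⟨f, (hinj.mono (subset_affineSpan ℝ P)).bijOn_image, ?_⟩
  have hspan : (affineSpan ℝ (f '' P) : Set (κ → ℝ)) = f '' affineSpan ℝ P := by
    rw [← AffineSubspace.map_span, AffineSubspace.coe_map]
  rw [hspan]
  refine ⟨fun x hx => ⟨(hint x hx.2).2 hx.1, mem_image_of_mem f hx.2⟩,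
    hinj.mono inter_subset_right, ?_⟩
  rintro _ ⟨hy, x, hx, rfl⟩
  exact ⟨x, ⟨(hint x hx).1 hy, hx⟩, rfl⟩

lemma mem_integerPoints_iff {ι : Type*} {x : ι → ℝ} :
    x ∈ integerPoints ι ↔ ∀ i, x i ∈ (Int.castAddHom ℝ).range :=
  forall_congr' fun i => by simp only [AddMonoidHom.mem_range, Int.coe_castAddHom, eq_comm]

/-! ### From order polytopes to flow polytopes -/

lemma bot_eq_zero_of_mem_affineSpan_orderPolytope {Q : Type*} [Preorder Q] [BoundedOrder Q]
    {f : Q → ℝ} (hf : f ∈ affineSpan ℝ (orderPolytope Q)) : f ⊥ = 0 :=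
  AffineMap.eqOn_affineSpan (f := (LinearMap.proj ⊥ : (Q → ℝ) →ₗ[ℝ] ℝ).toAffineMap)
    (g := AffineMap.const ℝ (Q → ℝ) 0) (fun _ hg => hg.1) hf

lemma apply_mem_of_coverDifference_mem {P : Type*} [PartialOrder P] [Finite P] (H : AddSubgroup ℝ)
    {f : PosetHat P → ℝ} (hbot : f ⊥ ∈ H) (h : ∀ e, coverDifference P f e ∈ H) (p : PosetHat P) :
    f p ∈ H := by
  induction p using WellFoundedLT.induction with
  | ind p ih =>
    rcases eq_bot_or_bot_lt p with rfl | hp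
    · exact hbot
    · obtain ⟨q, -, hqp⟩ := exists_le_covBy_of_lt hp
      have := H.add_mem (h ⟨(q, p), hqp⟩) (ih q hqp.lt)
      rwa [coverDifference_apply, sub_add_cancel] at this

lemma injOn_coverDifference {P : Type*} [PartialOrder P] [Finite P] :
    InjOn (coverDifference P) {f | f ⊥ = 0} := by
  intro f hf g hg hfg
  rw [mem_ofPred_eq] at hf hg
  funext p
  refine sub_eq_zero.1 (AddSubgroup.mem_bot.1 (apply_mem_of_coverDifference_mem ⊥ (f := f - g)
    ?_ (fun e => ?_) p))
  · rw [AddSubgroup.mem_bot, Pi.sub_apply, hf, hg, sub_zero]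
  · rw [AddSubgroup.mem_bot, map_sub, hfg, sub_self, Pi.zero_apply]

theorem integrallyEquivalent_orderPolytope_flowPolytope {P : Type*} [PartialOrder P] [Finite P]
    {D : AugmentedDrawing P} {k : ℕ} {G : OrderedGraph k (HasseEdge P)}
    (hG : IsTruncatedDual D G) :
    IntegrallyEquivalent (orderPolytope (PosetHat P)) (flowPolytope G) := by
  rw [AugmentedDrawing.flowPolytope_eq_image hG]
  refine integrallyEquivalent_image (coverDifference P).toAffineMap
    (injOn_coverDifference.mono fun f hf => bot_eq_zero_of_mem_affineSpan_orderPolytope hf)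
    fun f hf => ?_
  rw [mem_integerPoints_iff, mem_integerPoints_iff]
  refine ⟨fun h => apply_mem_of_coverDifference_mem _ ?_ h,
    fun h e => sub_mem (h e.1.2) (h e.1.1)⟩
  rw [bot_eq_zero_of_mem_affineSpan_orderPolytope hf]
  exact zero_mem _

/-! ### The vertices of an order polytope -/

section OrderPolytope

variable {Q : Type*} [Preorder Q] [BoundedOrder Q] {f : Q → ℝ}

lemma nonneg_of_mem_orderPolytope (hf : f ∈ orderPolytope Q) (q : Q) : 0 ≤ f q :=
  hf.1 ▸ hf.2.2 bot_le

lemma le_one_of_mem_orderPolytope (hf : f ∈ orderPolytope Q) (q : Q) : f q ≤ 1 :=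
  hf.2.1 ▸ hf.2.2 le_top

lemma convex_orderPolytope : Convex ℝ (orderPolytope Q) := by
  rintro f ⟨hf0, hf1, hf⟩ g ⟨hg0, hg1, hg⟩ a b ha hb hab
  refine ⟨?_, ?_, (hf.const_mul ha).add (hg.const_mul hb)⟩
  · simp [hf0, hg0]
  · simp [hf1, hg1, hab]

lemma indicator_support_mem_orderPolytope (hf : f ∈ orderPolytope Q) :
    (Function.support f).indicator 1 ∈ orderPolytope Q := by
  classical
  refine ⟨?_, ?_, fun p q hpq => ?_⟩
  · simp [hf.1]
  · simp [hf.2.1]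
  · refine indicator_apply_le' (fun hp => ?_) fun _ => indicator_nonneg (fun _ _ => zero_le_one) q
    have hq : q ∈ Function.support f := ne_of_gt <|
      ((nonneg_of_mem_orderPolytope hf p).lt_of_ne' hp).trans_le (hf.2.2 hpq)
    rw [indicator_of_mem hq]
    rfl

lemma monotone_sub_smul_indicator_support (hf : f ∈ orderPolytope Q) {ε : ℝ}
    (hε : ∀ q, f q ≠ 0 → ε ≤ f q) :
    Monotone (f - ε • (Function.support f).indicator (1 : Q → ℝ)) := by
  classical
  intro p q hpq
  simp only [Pi.sub_apply, Pi.smul_apply, indicator_apply, Function.mem_support, Pi.one_apply,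
    smul_eq_mul, mul_ite, mul_one, mul_zero]
  have hle := hf.2.2 hpq
  by_cases hp : f p = 0
  · rw [if_neg (not_not.2 hp), hp, sub_zero]
    split_ifs with hq
    · exact sub_nonneg.2 (hε q hq)
    · exact (not_not.1 hq).ge.trans_eq (sub_zero _).symm
  · have hq : f q ≠ 0 :=
      (((nonneg_of_mem_orderPolytope hf p).lt_of_ne' hp).trans_le hle).ne'
    rw [if_pos hp, if_pos hq]
    exact sub_le_sub_right hle ε

lemma peel_mem_orderPolytope (hf : f ∈ orderPolytope Q) {ε : ℝ} (hε1 : ε < 1)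
    (hε : ∀ q, f q ≠ 0 → ε ≤ f q) :
    (1 - ε)⁻¹ • (f - ε • (Function.support f).indicator (1 : Q → ℝ)) ∈ orderPolytope Q := by
  have hpos : 0 < 1 - ε := sub_pos.2 hε1
  refine ⟨?_, ?_, (monotone_sub_smul_indicator_support hf hε).const_mul (inv_nonneg.2 hpos.le)⟩
  · simp [hf.1]
  · simp [hf.2.1, hpos.ne']

/-- Subtracting from a point its least positive value on its support, and rescaling, leaves a point
with a smaller support. -/
lemma orderPolytope_subset_convexHull [Finite Q] :
    orderPolytope Q ⊆ convexHull ℝ {f ∈ orderPolytope Q | ∀ q, f q = 0 ∨ f q = 1} := by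
  intro f hf
  induction hN : (Function.support f).ncard using Nat.strong_induction_on generalizing f with
  | _ N ih =>
    have htop : ⊤ ∈ Function.support f := by simp [hf.2.1]
    obtain ⟨q₀, hq₀, hle⟩ := exists_min_image _ f (toFinite (Function.support f)) ⟨⊤, htop⟩
    set s : Q → ℝ := (Function.support f).indicator 1 with hs
    have hsmem : s ∈ convexHull ℝ {f ∈ orderPolytope Q | ∀ q, f q = 0 ∨ f q = 1} :=
      subset_convexHull ℝ _
        ⟨indicator_support_mem_orderPolytope hf, fun q => indicator_eq_zero_or_self _ _ q⟩
    rcases (le_one_of_mem_orderPolytope hf q₀).eq_or_lt with hone | hlt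
    · convert hsmem
      funext q
      by_cases hq : f q = 0
      · rw [hs, indicator_of_notMem (not_not.2 hq), hq]
      · rw [hs, indicator_of_mem hq]
        exact (le_one_of_mem_orderPolytope hf q).antisymm (hone ▸ hle q hq)
    · set g : Q → ℝ := (1 - f q₀)⁻¹ • (f - f q₀ • s) with hg
      have hssub : Function.support g ⊂ Function.support f := by
        have hsub : Function.support g ⊆ Function.support f := fun q hgq hq => hgq <| by
          simp [hg, hs, hq]
        exact (ssubset_iff_of_subset hsub).2 ⟨q₀, hq₀, fun h => h <| by
          simp [hg, hs, indicator_of_mem hq₀]⟩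
      have hgmem := ih _ (hN ▸ ncard_lt_ncard hssub (toFinite _))
        (peel_mem_orderPolytope hf hlt hle) rfl
      have hcomb : f = f q₀ • s + (1 - f q₀) • g := by
        rw [hg, smul_inv_smul₀ (sub_pos.2 hlt).ne', add_sub_cancel]
      rw [hcomb]
      exact convex_convexHull ℝ _ hsmem hgmem (nonneg_of_mem_orderPolytope hf q₀)
        (sub_pos.2 hlt).le (add_sub_cancel _ _)

theorem orderPolytope_eq_convexHull [Finite Q] :
    orderPolytope Q = convexHull ℝ {f ∈ orderPolytope Q | ∀ q, f q = 0 ∨ f q = 1} :=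
  orderPolytope_subset_convexHull.antisymm (convexHull_min (sep_subset _ _) convex_orderPolytope)

end OrderPolytope

/-! ### Functions on an augmented poset -/

namespace PosetHat

variable {P β : Type*}

/-- The inclusion of `P` into the augmented poset. -/
def of (p : P) : PosetHat P := ((p : WithTop P) : WithBot (WithTop P))

@[elab_as_elim]
lemma rec_of {motive : PosetHat P → Prop} (bot : motive ⊥) (top : motive ⊤)
    (of : ∀ p, motive (of p)) (v : PosetHat P) : motive v :=
  WithBot.recBotCoe bot (WithTop.recTopCoe top of) v

/-- The function on the augmented poset with the value `b` at `⊥`, the value `t` at `⊤`, and the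
values of `f` on `P`. -/
def elim (b t : β) (f : P → β) : PosetHat P → β :=
  WithBot.recBotCoe b (WithTop.recTopCoe t f)

@[simp] lemma elim_bot (b t : β) (f : P → β) : elim b t f ⊥ = b := rfl

@[simp] lemma elim_top (b t : β) (f : P → β) : elim b t f ⊤ = t := rfl

@[simp] lemma elim_of (b t : β) (f : P → β) (p : P) : elim b t f (of p) = f p := rfl

section Order

variable [PartialOrder P]

@[simp] lemma of_le_of {p q : P} : of p ≤ of q ↔ p ≤ q :=
  WithBot.coe_le_coe.trans WithTop.coe_le_coe

@[simp] lemma of_lt_of {p q : P} : of p < of q ↔ p < q :=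
  WithBot.coe_lt_coe.trans WithTop.coe_lt_coe

lemma bot_lt_of (p : P) : ⊥ < of p := WithBot.bot_lt_coe _

lemma of_lt_top (p : P) : of p < ⊤ := WithBot.coe_lt_coe.2 (WithTop.coe_lt_top p)

lemma monotone_elim [Preorder β] {b t : β} {f : P → β} (hbt : b ≤ t) (hf : Monotone f)
    (hb : ∀ p, b ≤ f p) (ht : ∀ p, f p ≤ t) : Monotone (elim b t f) := by
  intro v w hvw
  induction v using rec_of with
  | bot => induction w using rec_of with
    | bot => exact le_rfl
    | top => exact hbt
    | of q => exact hb q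
  | top => rw [top_le_iff.1 hvw]
  | of p => induction w using rec_of with
    | bot => exact absurd hvw (bot_lt_of p).not_ge
    | top => exact ht p
    | of q => exact hf (of_le_of.1 hvw)

lemma strictMono_elim [Preorder β] {b t : β} {f : P → β} (hbt : b < t) (hf : StrictMono f)
    (hb : ∀ p, b < f p) (ht : ∀ p, f p < t) : StrictMono (elim b t f) := by
  intro v w hvw
  induction v using rec_of with
  | bot => induction w using rec_of with
    | bot => exact absurd hvw (lt_irrefl _)
    | top => exact hbt
    | of q => exact hb q
  | top => exact absurd hvw not_top_lt
  | of p => induction w using rec_of with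
    | bot => exact absurd hvw not_lt_bot
    | top => exact ht p
    | of q => exact hf (of_lt_of.1 hvw)

end Order

end PosetHat

/-! ### Corner sums -/

section CornerSum

variable {m n : ℕ}

/-- The sum of the entries in the first `a` rows and the first `b` columns of an `m × n` matrix. -/
def cornerSum (a b : ℕ) : (Fin m × Fin n → ℝ) →ₗ[ℝ] ℝ :=
  ∑ x : Fin m × Fin n with (x.1 : ℕ) < a ∧ (x.2 : ℕ) < b, LinearMap.proj x

lemma cornerSum_apply (a b : ℕ) (A : Fin m × Fin n → ℝ) :
    cornerSum a b A = ∑ x : Fin m × Fin n with (x.1 : ℕ) < a ∧ (x.2 : ℕ) < b, A x := by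
  simp only [cornerSum, LinearMap.coe_sum, Finset.sum_apply, LinearMap.proj_apply]

lemma cornerSum_zero_left (b : ℕ) (A : Fin m × Fin n → ℝ) : cornerSum 0 b A = 0 := by
  simp [cornerSum_apply]

lemma cornerSum_zero_right (a : ℕ) (A : Fin m × Fin n → ℝ) : cornerSum a 0 A = 0 := by
  simp [cornerSum_apply]

lemma entry_eq_cornerSum (A : Fin m × Fin n → ℝ) (i : Fin m) (j : Fin n) :
    A (i, j) = cornerSum (i + 1) (j + 1) A - cornerSum i (j + 1) A - cornerSum (i + 1) j A +
      cornerSum i j A := by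
  simp only [cornerSum_apply, Finset.sum_filter]
  rw [← Finset.sum_sub_distrib, ← Finset.sum_sub_distrib, ← Finset.sum_add_distrib,
    Finset.sum_eq_single (i, j)]
  · simp
  · rintro ⟨i', j'⟩ - hne
    have h : ¬ ((i' : ℕ) = i ∧ (j' : ℕ) = j) := fun h =>
      hne (Prod.ext (Fin.ext h.1) (Fin.ext h.2))
    simp only
    split_ifs <;> first | omega | simp
  · simp

lemma entry_mem_of_cornerSum_mem (H : AddSubgroup ℝ) {A : Fin m × Fin n → ℝ}
    (h : ∀ i < m, ∀ j < n, cornerSum (i + 1) (j + 1) A ∈ H) (x : Fin m × Fin n) : A x ∈ H := by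
  have hcorner : ∀ a ≤ m, ∀ b ≤ n, cornerSum a b A ∈ H := by
    rintro (_ | i) hi (_ | j) hj
    · exact cornerSum_zero_left 0 A ▸ H.zero_mem
    · exact cornerSum_zero_left (j + 1) A ▸ H.zero_mem
    · exact cornerSum_zero_right (i + 1) A ▸ H.zero_mem
    · exact h i hi j hj
  obtain ⟨⟨i, hi⟩, ⟨j, hj⟩⟩ := x
  rw [entry_eq_cornerSum A ⟨i, hi⟩ ⟨j, hj⟩]
  exact H.add_mem (H.sub_mem (H.sub_mem (hcorner _ hi _ hj) (hcorner _ hi.le _ hj))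
    (hcorner _ hi _ hj.le)) (hcorner _ hi.le _ hj.le)

lemma sum_fin_filter_lt_eq_sum_range {M : Type*} [AddCommMonoid M] {a N : ℕ} (ha : a ≤ N)
    (f : ℕ → M) : ∑ x ∈ Finset.univ.filter fun x : Fin N => (x : ℕ) < a, f x =
      ∑ x ∈ Finset.range a, f x := by
  rw [Finset.sum_filter, Fin.sum_univ_eq_sum_range (fun x => if x < a then f x else 0),
    ← Finset.sum_filter]
  congr 1
  ext x
  simp only [Finset.mem_filter, Finset.mem_range]
  omega

lemma cornerSum_eq_sum_range {a b : ℕ} (ha : a ≤ m) (hb : b ≤ n) (F : ℕ → ℕ → ℝ) :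
    cornerSum a b (fun x : Fin m × Fin n => F x.1 x.2) =
      ∑ j ∈ Finset.range b, ∑ i ∈ Finset.range a, F i j := by
  have hprod : (Finset.univ.filter fun x : Fin m × Fin n => (x.1 : ℕ) < a ∧ (x.2 : ℕ) < b) =
      (Finset.univ.filter fun i : Fin m => (i : ℕ) < a) ×ˢ
        (Finset.univ.filter fun j : Fin n => (j : ℕ) < b) := by
    ext
    simp
  rw [cornerSum_apply, hprod, Finset.sum_product_right, ← sum_fin_filter_lt_eq_sum_range hb]
  simp only [← sum_fin_filter_lt_eq_sum_range ha]

end CornerSum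

/-! ### The matrix of a partition -/

lemma sum_partitionMatrixEntry (μ : YoungDiagram) (i j : ℕ) :
    ∑ k ∈ Finset.range (i + 1), partitionMatrixEntry μ k j = if j = μ.rowLen i then 1 else 0 := by
  induction i with
  | zero => simp [partitionMatrixEntry]
  | succ i ih =>
    rw [Finset.sum_range_succ, ih]
    have hanti : μ.rowLen (i + 1) ≤ μ.rowLen i := μ.rowLen_anti i (i + 1) (Nat.le_succ i)
    simp only [partitionMatrixEntry]
    split_ifs <;> omega

/-- The matrix `M^μ` as a point of `ℝ^{mn}`. -/
def partitionPoint (m n : ℕ) (μ : YoungDiagram) : Fin m × Fin n → ℝ :=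
  fun c => (partitionMatrix μ m n c.1 c.2 : ℝ)

lemma pasmPolytope_eq_convexHull (nu lam : YoungDiagram) (m n : ℕ) :
    pasmPolytope nu lam m n = convexHull ℝ (partitionPoint m n '' Icc lam nu) := by
  simp only [pasmPolytope, image, mem_Icc, and_assoc, eq_comm]
  rfl

open Classical in
lemma cornerSum_partitionPoint (μ : YoungDiagram) {m n i j : ℕ} (hi : i < m) (hj : j < n) :
    cornerSum (i + 1) (j + 1) (partitionPoint m n μ) = if (i, j) ∈ μ then 0 else 1 := by
  have hcolumn : ∀ b, ∑ a ∈ Finset.range (i + 1), (partitionMatrixEntry μ a b : ℝ) =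
      if b = μ.rowLen i then 1 else 0 := fun b => by
    exact_mod_cast congrArg (Int.cast : ℤ → ℝ) (sum_partitionMatrixEntry μ i b)
  rw [show partitionPoint m n μ = fun x => (partitionMatrixEntry μ x.1 x.2 : ℝ) from rfl,
    cornerSum_eq_sum_range hi hj fun a b => (partitionMatrixEntry μ a b : ℝ)]
  simp only [hcolumn, Finset.sum_ite_eq', Finset.mem_range, YoungDiagram.mem_iff_lt_rowLen]
  split_ifs <;> first | rfl | omega

/-! ### From matrices to order polytopes -/

section VertexValues

variable {nu lam : YoungDiagram} {m n : ℕ}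

/-- The corner sums of a matrix at the boxes of the skew shape, together with the values `0` at the
bottom and `1` at the top. -/
def vertexValues (nu lam : YoungDiagram) (m n : ℕ) :
    (Fin m × Fin n → ℝ) →ᵃ[ℝ] (PosetHat (SkewPoset nu lam) → ℝ) :=
  AffineMap.pi <| PosetHat.elim (AffineMap.const ℝ _ 0) (AffineMap.const ℝ _ 1)
    fun c => (cornerSum (c.1.1 + 1) (c.1.2 + 1)).toAffineMap

lemma vertexValues_apply (A : Fin m × Fin n → ℝ) : vertexValues nu lam m n A =
    PosetHat.elim 0 1 fun c => cornerSum (c.1.1 + 1) (c.1.2 + 1) A := by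
  funext v
  induction v using PosetHat.rec_of <;> rfl

lemma cornerSum_eq_of_mem_affineSpan_pasmPolytope {A : Fin m × Fin n → ℝ}
    (hA : A ∈ affineSpan ℝ (pasmPolytope nu lam m n)) {i j : ℕ} {r : ℝ}
    (hr : ∀ μ ∈ Icc lam nu, cornerSum (i + 1) (j + 1) (partitionPoint m n μ) = r) :
    cornerSum (i + 1) (j + 1) A = r := by
  rw [pasmPolytope_eq_convexHull, affineSpan_convexHull] at hA
  exact AffineMap.eqOn_affineSpan (f := (cornerSum (i + 1) (j + 1)).toAffineMap)
    (g := AffineMap.const ℝ _ r) (forall_mem_image.2 hr) hA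

lemma cornerSum_eq_zero_of_mem {A : Fin m × Fin n → ℝ}
    (hA : A ∈ affineSpan ℝ (pasmPolytope nu lam m n)) {i j : ℕ} (hi : i < m) (hj : j < n)
    (h : (i, j) ∈ lam) : cornerSum (i + 1) (j + 1) A = 0 := by
  classical
  refine cornerSum_eq_of_mem_affineSpan_pasmPolytope hA fun μ hμ => ?_
  rw [cornerSum_partitionPoint μ hi hj, if_pos (hμ.1 h)]

lemma cornerSum_eq_one_of_notMem {A : Fin m × Fin n → ℝ}
    (hA : A ∈ affineSpan ℝ (pasmPolytope nu lam m n)) {i j : ℕ} (hi : i < m) (hj : j < n)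
    (h : (i, j) ∉ nu) : cornerSum (i + 1) (j + 1) A = 1 := by
  classical
  refine cornerSum_eq_of_mem_affineSpan_pasmPolytope hA fun μ hμ => ?_
  rw [cornerSum_partitionPoint μ hi hj, if_neg fun hmem => h (hμ.2 hmem)]

lemma entry_mem_of_cornerSum_mem_of_skewPoset (H : AddSubgroup ℝ) {A : Fin m × Fin n → ℝ}
    (hin : ∀ i < m, ∀ j < n, (i, j) ∈ lam → cornerSum (i + 1) (j + 1) A ∈ H)
    (hout : ∀ i < m, ∀ j < n, (i, j) ∉ nu → cornerSum (i + 1) (j + 1) A ∈ H)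
    (hbox : ∀ c : SkewPoset nu lam, cornerSum (c.1.1 + 1) (c.1.2 + 1) A ∈ H)
    (x : Fin m × Fin n) : A x ∈ H := by
  refine entry_mem_of_cornerSum_mem H (fun i hi j hj => ?_) x
  by_cases hlam : (i, j) ∈ lam
  · exact hin i hi j hj hlam
  by_cases hnu : (i, j) ∈ nu
  · exact hbox ⟨(i, j), hnu, hlam⟩
  · exact hout i hi j hj hnu

lemma injOn_vertexValues : InjOn (vertexValues nu lam m n)
    (affineSpan ℝ (pasmPolytope nu lam m n) : Set (Fin m × Fin n → ℝ)) := by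
  intro A hA B hB hAB
  funext x
  refine sub_eq_zero.1 (AddSubgroup.mem_bot.1 (entry_mem_of_cornerSum_mem_of_skewPoset
    (nu := nu) (lam := lam) ⊥ (A := A - B) ?_ ?_ ?_ x)) <;>
    simp only [map_sub, AddSubgroup.mem_bot, sub_eq_zero]
  · intro i hi j hj h
    rw [cornerSum_eq_zero_of_mem hA hi hj h, cornerSum_eq_zero_of_mem hB hi hj h]
  · intro i hi j hj h
    rw [cornerSum_eq_one_of_notMem hA hi hj h, cornerSum_eq_one_of_notMem hB hi hj h]
  · intro c
    simpa only [vertexValues_apply, PosetHat.elim_of] using congrFun hAB (PosetHat.of c)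

lemma vertexValues_mem_integerPoints_iff {A : Fin m × Fin n → ℝ}
    (hA : A ∈ affineSpan ℝ (pasmPolytope nu lam m n)) :
    vertexValues nu lam m n A ∈ integerPoints _ ↔ A ∈ integerPoints _ := by
  have hone : (1 : ℝ) ∈ (Int.castAddHom ℝ).range := ⟨1, Int.cast_one⟩
  simp only [mem_integerPoints_iff, vertexValues_apply]
  constructor
  · intro h
    refine entry_mem_of_cornerSum_mem_of_skewPoset (nu := nu) (lam := lam) _
      (fun i hi j hj hc => ?_) (fun i hi j hj hc => ?_) fun c => h (PosetHat.of c)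
    · exact cornerSum_eq_zero_of_mem hA hi hj hc ▸ zero_mem _
    · exact cornerSum_eq_one_of_notMem hA hi hj hc ▸ hone
  · intro h v
    induction v using PosetHat.rec_of with
    | bot => exact zero_mem _
    | top => exact hone
    | of c =>
      rw [PosetHat.elim_of, cornerSum_apply]
      exact sum_mem fun x _ => h x

open Classical in
lemma vertexValues_partitionPoint (hnu : ∀ c ∈ nu, c.1 < m ∧ c.2 < n) (μ : YoungDiagram) :
    vertexValues nu lam m n (partitionPoint m n μ) =
      PosetHat.elim 0 1 fun c => if c.1 ∈ μ then 0 else 1 := by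
  rw [vertexValues_apply]
  congr
  funext c
  obtain ⟨hi, hj⟩ := hnu c.1 c.2.1
  exact cornerSum_partitionPoint μ hi hj

lemma vertexValues_partitionPoint_mem (hnu : ∀ c ∈ nu, c.1 < m ∧ c.2 < n) (μ : YoungDiagram) :
    vertexValues nu lam m n (partitionPoint m n μ) ∈
      orderPolytope (PosetHat (SkewPoset nu lam)) := by
  classical
  rw [vertexValues_partitionPoint hnu]
  refine ⟨rfl, rfl, PosetHat.monotone_elim zero_le_one (fun c d hcd => ?_) (fun c => ?_)
    fun c => ?_⟩
  · have hlower : d.1 ∈ μ → c.1 ∈ μ := fun hd => μ.isLowerSet hcd hd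
    split_ifs <;> simp_all
  all_goals split_ifs <;> norm_num

open Classical in
/-- The partition `μ ⊆ ν` that consists of the common boxes of `λ` and `ν` and of the boxes in the
order ideal `I` of the skew shape. -/
def partitionOfIdeal (I : LowerSet (SkewPoset nu lam)) : YoungDiagram where
  cells := nu.cells.filter fun c => ∀ h : c ∈ nu ∧ c ∉ lam, (⟨c, h⟩ : SkewPoset nu lam) ∈ I
  isLowerSet c d hdc hc := by
    simp only [Finset.coe_filter, YoungDiagram.mem_cells, mem_ofPred_eq] at hc ⊢
    exact ⟨nu.isLowerSet hdc hc.1, fun h =>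
      I.lower hdc (hc.2 ⟨hc.1, fun hlam => h.2 (lam.isLowerSet hdc hlam)⟩)⟩

lemma mem_partitionOfIdeal {I : LowerSet (SkewPoset nu lam)} {c : ℕ × ℕ} :
    c ∈ partitionOfIdeal I ↔ c ∈ nu ∧ ∀ h : c ∈ nu ∧ c ∉ lam, ⟨c, h⟩ ∈ I := by
  classical exact Finset.mem_filter

lemma partitionOfIdeal_mem_Icc (hlam : lam ≤ nu) (I : LowerSet (SkewPoset nu lam)) :
    partitionOfIdeal I ∈ Icc lam nu :=
  ⟨fun _ hc => mem_partitionOfIdeal.2 ⟨hlam hc, fun h => absurd hc h.2⟩,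
    fun _ hc => (mem_partitionOfIdeal.1 hc).1⟩

lemma vertexValues_image_partitionPoint (hlam : lam ≤ nu) (hnu : ∀ c ∈ nu, c.1 < m ∧ c.2 < n) :
    vertexValues nu lam m n '' (partitionPoint m n '' Icc lam nu) =
      {f ∈ orderPolytope (PosetHat (SkewPoset nu lam)) | ∀ v, f v = 0 ∨ f v = 1} := by
  classical
  refine Subset.antisymm ?_ ?_
  · rintro _ ⟨_, ⟨μ, -, rfl⟩, rfl⟩
    refine ⟨vertexValues_partitionPoint_mem hnu μ, fun v => ?_⟩
    rw [vertexValues_partitionPoint hnu]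
    induction v using PosetHat.rec_of with
    | bot => exact .inl rfl
    | top => exact .inr rfl
    | of c => exact (ite_eq_or_eq _ _ _)
  · rintro f ⟨⟨hbot, htop, hmono⟩, hf⟩
    let I : LowerSet (SkewPoset nu lam) :=
      ⟨{c | f (PosetHat.of c) = 0}, fun c d hdc (hc : f (PosetHat.of c) = 0) =>
        le_antisymm (hc ▸ hmono (PosetHat.of_le_of.2 hdc)) (hbot ▸ hmono bot_le)⟩
    have hI : ∀ c : SkewPoset nu lam, c.1 ∈ partitionOfIdeal I ↔ f (PosetHat.of c) = 0 :=
      fun c => mem_partitionOfIdeal.trans ⟨fun h => h.2 c.2, fun h => ⟨c.2.1, fun _ => h⟩⟩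
    refine ⟨_, ⟨partitionOfIdeal I, partitionOfIdeal_mem_Icc hlam I, rfl⟩, ?_⟩
    rw [vertexValues_partitionPoint hnu]
    funext v
    induction v using PosetHat.rec_of with
    | bot => exact hbot.symm
    | top => exact htop.symm
    | of c =>
      simp only [PosetHat.elim_of, hI]
      split_ifs with h
      · exact h.symm
      · exact ((hf _).resolve_left h).symm

lemma vertexValues_image_pasmPolytope (hlam : lam ≤ nu) (hnu : ∀ c ∈ nu, c.1 < m ∧ c.2 < n) :
    vertexValues nu lam m n '' pasmPolytope nu lam m n =
      orderPolytope (PosetHat (SkewPoset nu lam)) := by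
  rw [pasmPolytope_eq_convexHull, AffineMap.image_convexHull,
    vertexValues_image_partitionPoint hlam hnu, ← orderPolytope_eq_convexHull]

theorem integrallyEquivalent_pasmPolytope_orderPolytope (hlam : lam ≤ nu)
    (hnu : ∀ c ∈ nu, c.1 < m ∧ c.2 < n) :
    IntegrallyEquivalent (pasmPolytope nu lam m n)
      (orderPolytope (PosetHat (SkewPoset nu lam))) := by
  rw [← vertexValues_image_pasmPolytope hlam hnu]
  exact integrallyEquivalent_image _ injOn_vertexValues fun _ => vertexValues_mem_integerPoints_iff

end VertexValues

/-! ### Drawing a skew shape -/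

namespace PosetHat

variable {P : Type*} [PartialOrder P]

lemma of_covBy_of {p q : P} : of p ⋖ of q ↔ p ⋖ q :=
  WithBot.coe_covBy_coe.trans WithTop.coe_covBy_coe

lemma covBy_cases {v w : PosetHat P} (h : v ⋖ w) :
    (v = ⊥ ∧ w = ⊤) ∨ (∃ q, v = ⊥ ∧ w = of q) ∨ (∃ p, v = of p ∧ w = ⊤) ∨
      ∃ p q, p ⋖ q ∧ v = of p ∧ w = of q := by
  induction v using rec_of with
  | bot => induction w using rec_of with
    | bot => exact absurd h.lt (lt_irrefl _)
    | top => exact .inl ⟨rfl, rfl⟩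
    | of q => exact .inr (.inl ⟨q, rfl, rfl⟩)
  | top => exact absurd h.lt not_top_lt
  | of p => induction w using rec_of with
    | bot => exact absurd h.lt not_lt_bot
    | top => exact .inr (.inr (.inl ⟨p, rfl, rfl⟩))
    | of q => exact .inr (.inr (.inr ⟨p, q, of_covBy_of.1 h, rfl, rfl⟩))

lemma eq_bot_of_apply_le {β : Type*} [Preorder β] {f : PosetHat P → β} (hf : StrictMono f)
    {v : PosetHat P} (h : f v ≤ f ⊥) : v = ⊥ := by
  by_contra hne
  exact (hf (bot_lt_iff_ne_bot.2 hne)).not_ge h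

lemma eq_top_of_le_apply {β : Type*} [Preorder β] {f : PosetHat P → β} (hf : StrictMono f)
    {v : PosetHat P} (h : f ⊤ ≤ f v) : v = ⊤ := by
  by_contra hne
  exact (hf (lt_top_iff_ne_top.2 hne)).not_ge h

lemma subsingleton_hasseEdge (h : (⊥ : PosetHat P) ⋖ ⊤) : Subsingleton (HasseEdge P) := by
  suffices ∀ e : HasseEdge P, e.1 = (⊥, ⊤) from
    ⟨fun e e' => Subtype.ext ((this e).trans (this e').symm)⟩
  intro e
  refine Prod.ext ((h.eq_or_eq bot_le le_top).resolve_right ?_)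
    ((h.eq_or_eq bot_le le_top).resolve_left ?_)
  · exact (e.2.lt.trans_le le_top).ne
  · exact (bot_le.trans_lt e.2.lt).ne'

end PosetHat

open PosetHat

lemma eq_and_eq_of_intCast_add_eq {a b : ℤ} {s t : ℝ} (hs : s ∈ Ico (0 : ℝ) 1)
    (ht : t ∈ Ico (0 : ℝ) 1) (h : a + s = b + t) : a = b ∧ s = t := by
  have hab : a = b := by
    simpa only [Int.floor_intCast_add, Int.floor_eq_zero_iff.2 hs, Int.floor_eq_zero_iff.2 ht,
      add_zero] using congrArg Int.floor h
  exact ⟨hab, by simpa only [hab, add_right_inj] using h⟩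

namespace SkewPoset

variable {nu lam : YoungDiagram} {b c d c' d' : SkewPoset nu lam}

lemma val_eq_of_covBy (h : c ⋖ d) : d.1 = (c.1.1 + 1, c.1.2) ∨ d.1 = (c.1.1, c.1.2 + 1) := by
  have hconn : (range (OrderEmbedding.subtype fun x : ℕ × ℕ => x ∈ nu ∧ x ∉ lam)).OrdConnected :=
    Subtype.range_coe ▸ nu.isLowerSet.ordConnected.inter lam.isLowerSet.compl.ordConnected
  have hval : c.1 ⋖ d.1 := (hconn.apply_covBy_apply_iff _).2 h
  simp only [Prod.covBy_iff, Nat.covBy_iff_add_one_eq] at hval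
  simp only [Prod.ext_iff]
  omega

/-- The horizontal coordinate of a box, which is constant on diagonals. -/
def boxX (c : SkewPoset nu lam) : ℝ := c.1.2 - c.1.1

/-- The height of a box, which is constant on antidiagonals. -/
def boxHeight (c : SkewPoset nu lam) : ℝ := c.1.1 + c.1.2

lemma boxX_eq_of_covBy (h : c ⋖ d) : boxX d = boxX c - 1 ∨ boxX d = boxX c + 1 := by
  refine (val_eq_of_covBy h).imp (fun hd => ?_) fun hd => ?_ <;>
    simp only [boxX, hd] <;> push_cast <;> ring

lemma boxHeight_eq_of_covBy (h : c ⋖ d) : boxHeight d = boxHeight c + 1 := by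
  rcases val_eq_of_covBy h with hd | hd <;> simp only [boxHeight, hd] <;> push_cast <;> ring

lemma boxHeight_nonneg (c : SkewPoset nu lam) : 0 ≤ boxHeight c := by
  unfold boxHeight
  positivity

lemma strictMono_boxHeight : StrictMono (boxHeight : SkewPoset nu lam → ℝ) := by
  intro c d h
  have hsum : c.1.1 + c.1.2 < d.1.1 + d.1.2 := by
    rcases Prod.lt_iff.1 (show c.1 < d.1 from h) with ⟨h₁, h₂⟩ | ⟨h₁, h₂⟩ <;> omega
  unfold boxHeight
  exact_mod_cast hsum

lemma le_of_boxX_eq (hx : boxX c = boxX d) (hy : boxHeight c ≤ boxHeight d) : c ≤ d := by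
  unfold boxX at hx
  unfold boxHeight at hy
  refine Prod.le_def.2 ⟨?_, ?_⟩
  · exact_mod_cast (by linarith : (c.1.1 : ℝ) ≤ d.1.1)
  · exact_mod_cast (by linarith : (c.1.2 : ℝ) ≤ d.1.2)

lemma eq_of_boxX_eq_of_boxHeight_eq (hx : boxX c = boxX d) (hy : boxHeight c = boxHeight d) :
    c = d :=
  le_antisymm (le_of_boxX_eq hx hy.le) (le_of_boxX_eq hx.symm hy.ge)

lemma boxHeight_le_of_bot_covBy (h : ⊥ ⋖ of c) (hx : boxX b = boxX c) :
    boxHeight c ≤ boxHeight b := by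
  by_contra! hlt
  have hbc : b < c := (le_of_boxX_eq hx hlt.le).lt_of_ne fun hbc => hlt.ne (hbc ▸ rfl)
  exact h.2 (bot_lt_of b) (of_lt_of.2 hbc)

lemma boxHeight_le_of_covBy_top (h : of c ⋖ ⊤) (hx : boxX b = boxX c) :
    boxHeight b ≤ boxHeight c := by
  by_contra! hlt
  have hcb : c < b := (le_of_boxX_eq hx.symm hlt.le).lt_of_ne fun hcb => hlt.ne (hcb ▸ rfl)
  exact h.2 (of_lt_of.2 hcb) (of_lt_top b)

lemma boxX_ne_of_covBy (b : SkewPoset nu lam) (h : c ⋖ d) {t : ℝ} (ht : t ∈ Ioo (0 : ℝ) 1) :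
    boxX b ≠ boxX c + (boxX d - boxX c) * t := by
  have hzero : (0 : ℝ) ∈ Ico (0 : ℝ) 1 := ⟨le_rfl, one_pos⟩
  have ht' : t ∈ Ico (0 : ℝ) 1 := ⟨ht.1.le, ht.2⟩
  intro heq
  rcases boxX_eq_of_covBy h with hd | hd <;> rw [hd] at heq <;> unfold boxX at heq
  · refine ht.1.ne' (eq_and_eq_of_intCast_add_eq (a := b.1.2 - b.1.1) (b := c.1.2 - c.1.1)
      ht' hzero ?_).2
    push_cast
    linarith
  · refine ht.1.ne (eq_and_eq_of_intCast_add_eq (a := b.1.2 - b.1.1) (b := c.1.2 - c.1.1)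
      hzero ht' ?_).2
    push_cast
    linarith

lemma boxHeight_eq_and_eq {s t : ℝ} (hs : s ∈ Ico (0 : ℝ) 1) (ht : t ∈ Ico (0 : ℝ) 1)
    (h : boxHeight c + s = boxHeight d + t) : boxHeight c = boxHeight d ∧ s = t := by
  unfold boxHeight at h ⊢
  have hint := eq_and_eq_of_intCast_add_eq (a := c.1.1 + c.1.2) (b := d.1.1 + d.1.2) hs ht
    (by push_cast; exact h)
  exact ⟨by exact_mod_cast hint.1, hint.2⟩

lemma eq_and_eq_of_inner_eq (hcd : c ⋖ d) (hcd' : c' ⋖ d') {t t' : ℝ} (ht : t ∈ Ioo (0 : ℝ) 1)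
    (ht' : t' ∈ Ioo (0 : ℝ) 1) (hy : boxHeight c + t = boxHeight c' + t')
    (hx : boxX c + (boxX d - boxX c) * t = boxX c' + (boxX d' - boxX c') * t') :
    c = c' ∧ d = d' := by
  have hzero : (0 : ℝ) ∈ Ico (0 : ℝ) 1 := ⟨le_rfl, one_pos⟩
  obtain ⟨hheight, rfl⟩ := boxHeight_eq_and_eq ⟨ht.1.le, ht.2⟩ ⟨ht'.1.le, ht'.2⟩ hy
  have hheight' : boxHeight d = boxHeight d' := by
    rw [boxHeight_eq_of_covBy hcd, boxHeight_eq_of_covBy hcd', hheight]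
  suffices boxX c = boxX c' ∧ boxX d = boxX d' from
    ⟨eq_of_boxX_eq_of_boxHeight_eq this.1 hheight, eq_of_boxX_eq_of_boxHeight_eq this.2 hheight'⟩
  rcases boxX_eq_of_covBy hcd with hd | hd <;> rcases boxX_eq_of_covBy hcd' with hd' | hd' <;>
    rw [hd, hd'] at hx
  · constructor <;> linarith
  · refine absurd (eq_and_eq_of_intCast_add_eq (a := c.1.2) (b := c'.1.2) hzero
      ⟨ht.1.le, ht.2⟩ ?_).2 ht.1.ne
    unfold boxX boxHeight at *
    push_cast
    linarith
  · refine absurd (eq_and_eq_of_intCast_add_eq (a := c.1.2) (b := c'.1.2)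
      ⟨ht.1.le, ht.2⟩ hzero ?_).2 ht.1.ne'
    unfold boxX boxHeight at *
    push_cast
    linarith
  · constructor <;> linarith

/-- The points of the edge `e` in the drawing of the skew shape before it is tapered towards the
bottom and the top: a box at an end of `e`, a point vertically below a minimal or above a maximal
box, an inner point of the segment joining neighbouring boxes, or a point of the edge from `⊥` to
`⊤` of the empty shape. -/
inductive EdgePoint (e : HasseEdge (SkewPoset nu lam)) (x y : ℝ) : Prop
  | vertex (c : SkewPoset nu lam) (he : of c = e.1.1 ∨ of c = e.1.2) (hx : x = boxX c)
      (hy : y = boxHeight c)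
  | vertical (c : SkewPoset nu lam) (hx : x = boxX c)
      (he : e.1 = (⊥, of c) ∧ y < boxHeight c ∨ e.1 = (of c, ⊤) ∧ boxHeight c < y)
  | inner (c d : SkewPoset nu lam) (hcd : c ⋖ d) (he : e.1 = (of c, of d)) (t : ℝ)
      (ht : t ∈ Ioo (0 : ℝ) 1) (hx : x = boxX c + (boxX d - boxX c) * t)
      (hy : y = boxHeight c + t)
  | empty (he : e.1 = (⊥, ⊤)) (hx : x = 0)

namespace EdgePoint

variable {e e' : HasseEdge (SkewPoset nu lam)} {x y : ℝ}

lemma eq_end (h : EdgePoint e (boxX b) (boxHeight b)) : of b = e.1.1 ∨ of b = e.1.2 := by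
  obtain ⟨e, hcov⟩ := e
  cases h with
  | vertex c he hx hy => exact eq_of_boxX_eq_of_boxHeight_eq hx hy ▸ he
  | vertical c hx he =>
    rcases he with ⟨rfl, hy⟩ | ⟨rfl, hy⟩
    · exact absurd (boxHeight_le_of_bot_covBy hcov hx) hy.not_ge
    · exact absurd (boxHeight_le_of_covBy_top hcov hx) hy.not_ge
  | inner c d hcd he t ht hx => exact absurd hx (boxX_ne_of_covBy b hcd ht)
  | empty he =>
    obtain rfl := he
    exact (hcov.2 (bot_lt_of b) (of_lt_top b)).elim

lemma edge_eq_of_vertical (hx : boxX c = boxX c')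
    (he : e.1 = (⊥, of c) ∧ y < boxHeight c ∨ e.1 = (of c, ⊤) ∧ boxHeight c < y)
    (he' : e'.1 = (⊥, of c') ∧ y < boxHeight c' ∨ e'.1 = (of c', ⊤) ∧ boxHeight c' < y) :
    e = e' := by
  obtain ⟨e, hcov⟩ := e
  obtain ⟨e', hcov'⟩ := e'
  rcases he with ⟨rfl, hy⟩ | ⟨rfl, hy⟩ <;> rcases he' with ⟨rfl, hy'⟩ | ⟨rfl, hy'⟩
  · obtain rfl : c = c' := eq_of_boxX_eq_of_boxHeight_eq hx
      ((boxHeight_le_of_bot_covBy hcov hx.symm).antisymm (boxHeight_le_of_bot_covBy hcov' hx))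
    rfl
  · linarith [boxHeight_le_of_bot_covBy hcov hx.symm]
  · linarith [boxHeight_le_of_bot_covBy hcov' hx]
  · obtain rfl : c = c' := eq_of_boxX_eq_of_boxHeight_eq hx
      ((boxHeight_le_of_covBy_top hcov' hx).antisymm (boxHeight_le_of_covBy_top hcov hx.symm))
    rfl

lemma exists_box (h : EdgePoint e x y) (h' : EdgePoint e' x y) (hne : e ≠ e') :
    ∃ c : SkewPoset nu lam, boxX c = x ∧ boxHeight c = y := by
  obtain ⟨e, hcov⟩ := e
  obtain ⟨e', hcov'⟩ := e'
  cases h with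
  | vertex c he hx hy => exact ⟨c, hx.symm, hy.symm⟩
  | empty he =>
    obtain rfl := he
    exact absurd (subsingleton_hasseEdge hcov |>.elim _ _) hne
  | vertical c hx he => cases h' with
    | vertex c' he' hx' hy' => exact ⟨c', hx'.symm, hy'.symm⟩
    | empty he' =>
      obtain rfl := he'
      exact absurd (subsingleton_hasseEdge hcov' |>.elim _ _) hne
    | vertical c' hx' he' => exact absurd (edge_eq_of_vertical (hx.symm.trans hx') he he') hne
    | inner c' d' hcd' he' t' ht' hx' =>
      exact absurd (hx.symm.trans hx') (boxX_ne_of_covBy c hcd' ht')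
  | inner c d hcd he t ht hx hy => cases h' with
    | vertex c' he' hx' hy' => exact ⟨c', hx'.symm, hy'.symm⟩
    | empty he' =>
      obtain rfl := he'
      exact absurd (subsingleton_hasseEdge hcov' |>.elim _ _) hne
    | vertical c' hx' he' => exact absurd (hx'.symm.trans hx) (boxX_ne_of_covBy c' hcd ht)
    | inner c' d' hcd' he' t' ht' hx' hy' =>
      obtain ⟨rfl, rfl⟩ := eq_and_eq_of_inner_eq hcd hcd' ht ht' (hy.symm.trans hy')
        (hx.symm.trans hx')
      exact absurd (Subtype.ext (he.trans he'.symm)) hne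

end EdgePoint

/-- The largest height `i + j` of a box of `ν`. -/
def maxHeight (nu : YoungDiagram) : ℕ := nu.cells.sup fun c => c.1 + c.2

lemma boxHeight_le (c : SkewPoset nu lam) : boxHeight c ≤ maxHeight nu := by
  unfold boxHeight
  exact_mod_cast Finset.le_sup (f := fun c : ℕ × ℕ => c.1 + c.2) c.2.1

lemma abs_boxX_le (c : SkewPoset nu lam) : |boxX c| ≤ boxHeight c := by
  simpa only [boxX, boxHeight, Nat.abs_cast, add_comm] using abs_sub (c.1.2 : ℝ) c.1.1

lemma EdgePoint.abs_lt_maxHeight_add_one {e : HasseEdge (SkewPoset nu lam)} {x y : ℝ}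
    (h : EdgePoint e x y) : |x| < maxHeight nu + 1 := by
  have hbox : ∀ c : SkewPoset nu lam, |boxX c| ≤ maxHeight nu := fun c =>
    (abs_boxX_le c).trans (boxHeight_le c)
  cases h with
  | vertex c he hx => exact hx ▸ (hbox c).trans_lt (lt_add_one _)
  | vertical c hx => exact hx ▸ (hbox c).trans_lt (lt_add_one _)
  | inner c d hcd he t ht hx =>
    have hstep : |(boxX d - boxX c) * t| < 1 := by
      rcases boxX_eq_of_covBy hcd with hd | hd <;> rw [hd] <;>
        exact abs_lt.2 ⟨by linarith [ht.1, ht.2], by linarith [ht.1, ht.2]⟩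
    exact hx ▸ (abs_add_le _ _).trans_lt (add_lt_add_of_le_of_lt (hbox c) hstep)
  | empty he hx =>
    rw [hx, abs_zero]
    positivity

/-- The horizontal coordinates of the vertices. -/
def hatX : PosetHat (SkewPoset nu lam) → ℝ := elim 0 0 boxX

/-- The heights of the vertices. -/
def hatHeight : PosetHat (SkewPoset nu lam) → ℝ := elim (-1) (maxHeight nu + 1) boxHeight

lemma strictMono_hatHeight : StrictMono (hatHeight : PosetHat (SkewPoset nu lam) → ℝ) :=
  strictMono_elim (neg_one_lt_zero.trans (by positivity)) strictMono_boxHeight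
    (fun c => neg_one_lt_zero.trans_le (boxHeight_nonneg c))
    fun c => (boxHeight_le c).trans_lt (lt_add_one _)

/-- The horizontal coordinate of the lower end of an edge before tapering: an edge from `⊥` is
vertical. -/
def footX (e : HasseEdge (SkewPoset nu lam)) : ℝ := elim (hatX e.1.2) 0 boxX e.1.1

/-- The horizontal coordinate of the upper end of an edge before tapering: an edge to `⊤` is
vertical. -/
def headX (e : HasseEdge (SkewPoset nu lam)) : ℝ := elim 0 (hatX e.1.1) boxX e.1.2

/-- The horizontal coordinate of an edge before tapering. Edges between boxes have height `1`, the
other ones are vertical, so there is no need to divide the slope by the height of the edge. -/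
def lineX (e : HasseEdge (SkewPoset nu lam)) (y : ℝ) : ℝ :=
  footX e + (headX e - footX e) * (y - hatHeight e.1.1)

lemma continuous_lineX (e : HasseEdge (SkewPoset nu lam)) : Continuous (lineX e) := by
  unfold lineX
  fun_prop

lemma lineX_footHeight (e : HasseEdge (SkewPoset nu lam)) :
    lineX e (hatHeight e.1.1) = footX e := by
  rw [lineX, sub_self, mul_zero, add_zero]

lemma lineX_headHeight (e : HasseEdge (SkewPoset nu lam)) :
    lineX e (hatHeight e.1.2) = headX e := by
  obtain ⟨⟨v, w⟩, h⟩ := e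
  rcases covBy_cases h with ⟨rfl, rfl⟩ | ⟨d, rfl, rfl⟩ | ⟨c, rfl, rfl⟩ | ⟨c, d, hcd, rfl, rfl⟩
  on_goal 4 => simp [lineX, footX, headX, hatHeight, boxHeight_eq_of_covBy hcd]
  all_goals simp [lineX, footX, headX, hatX]

lemma edgePoint_lineX (e : HasseEdge (SkewPoset nu lam)) {y : ℝ}
    (hy : y ∈ Icc (hatHeight e.1.1) (hatHeight e.1.2)) : EdgePoint e (lineX e y) y := by
  obtain ⟨⟨v, w⟩, hcov⟩ := e
  rcases covBy_cases hcov with ⟨rfl, rfl⟩ | ⟨d, rfl, rfl⟩ | ⟨c, rfl, rfl⟩ | ⟨c, d, hcd, rfl, rfl⟩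
  · exact .empty rfl (by simp [lineX, footX, headX, hatX])
  · have hx : lineX ⟨(⊥, of d), hcov⟩ y = boxX d := by simp [lineX, footX, headX, hatX]
    rcases hy.2.eq_or_lt with hd | hd
    · exact .vertex d (.inr rfl) hx hd
    · exact .vertical d hx (.inl ⟨rfl, hd⟩)
  · have hx : lineX ⟨(of c, ⊤), hcov⟩ y = boxX c := by simp [lineX, footX, headX, hatX]
    rcases hy.1.eq_or_lt with hc | hc
    · exact .vertex c (.inl rfl) hx hc.symm
    · exact .vertical c hx (.inr ⟨rfl, hc⟩)
  · rcases hy.1.eq_or_lt with hc | hc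
    · exact .vertex c (.inl rfl) (hc ▸ lineX_footHeight _) hc.symm
    rcases hy.2.eq_or_lt with hd | hd
    · exact .vertex d (.inr rfl) (hd ▸ lineX_headHeight _) hd
    have hlt : y < boxHeight c + 1 := hd.trans_eq (boxHeight_eq_of_covBy hcd)
    exact .inner c d hcd rfl (y - boxHeight c) ⟨sub_pos.2 hc, sub_lt_iff_lt_add'.2 hlt⟩ rfl
      (add_sub_cancel _ _).symm

/-- The factor that contracts the drawing towards the bottom and the top. -/
def taper (N : ℕ) (y : ℝ) : ℝ := min 1 (min (y + 1) (N + 1 - y))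

lemma continuous_taper (N : ℕ) : Continuous (taper N) := by
  unfold taper
  fun_prop

lemma taper_neg_one (N : ℕ) : taper N (-1) = 0 := by
  have hN : (0 : ℝ) ≤ N + 1 - -1 := by linarith [N.cast_nonneg (α := ℝ)]
  rw [taper, neg_add_cancel, min_eq_left hN, min_eq_right zero_le_one]

lemma taper_add_one (N : ℕ) : taper N (N + 1) = 0 := by
  have hN : (0 : ℝ) ≤ N + 1 + 1 := by positivity
  rw [taper, sub_self, min_eq_right hN, min_eq_right zero_le_one]

lemma taper_pos {N : ℕ} {y : ℝ} (hbot : -1 < y) (htop : y < N + 1) : 0 < taper N y :=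
  lt_min one_pos (lt_min (by linarith) (by linarith))

lemma taper_boxHeight (c : SkewPoset nu lam) : taper (maxHeight nu) (boxHeight c) = 1 :=
  min_eq_left (le_min (by linarith [boxHeight_nonneg c]) (by linarith [boxHeight_le c]))

lemma footX_mul_taper (e : HasseEdge (SkewPoset nu lam)) :
    footX e * taper (maxHeight nu) (hatHeight e.1.1) = hatX e.1.1 := by
  obtain ⟨⟨v, w⟩, h⟩ := e
  induction v using rec_of with
  | bot => exact mul_eq_zero_of_right _ (taper_neg_one _)
  | top => exact absurd h.lt not_top_lt
  | of c => exact (congrArg (boxX c * ·) (taper_boxHeight c)).trans (mul_one _)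

lemma headX_mul_taper (e : HasseEdge (SkewPoset nu lam)) :
    headX e * taper (maxHeight nu) (hatHeight e.1.2) = hatX e.1.2 := by
  obtain ⟨⟨v, w⟩, h⟩ := e
  induction w using rec_of with
  | bot => exact absurd h.lt not_lt_bot
  | top => exact mul_eq_zero_of_right _ (taper_add_one _)
  | of d => exact (congrArg (boxX d * ·) (taper_boxHeight d)).trans (mul_one _)

lemma eq_end_of_lineX_mul_taper_eq (e : HasseEdge (SkewPoset nu lam))
    (v : PosetHat (SkewPoset nu lam))
    (hv : hatHeight v ∈ Icc (hatHeight e.1.1) (hatHeight e.1.2))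
    (h : lineX e (hatHeight v) * taper (maxHeight nu) (hatHeight v) = hatX v) :
    v = e.1.1 ∨ v = e.1.2 := by
  induction v using rec_of with
  | bot => exact .inl (eq_bot_of_apply_le strictMono_hatHeight hv.1).symm
  | top => exact .inr (eq_top_of_le_apply strictMono_hatHeight hv.2).symm
  | of b =>
    have hx : lineX e (boxHeight b) = boxX b := by
      rwa [← mul_one (lineX e _), ← taper_boxHeight b]
    exact EdgePoint.eq_end (hx ▸ edgePoint_lineX e hv)

lemma exists_vertex_of_lineX_mul_taper_eq {e e' : HasseEdge (SkewPoset nu lam)} {y : ℝ}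
    (hne : e ≠ e') (hy : y ∈ Icc (hatHeight e.1.1) (hatHeight e.1.2))
    (hy' : y ∈ Icc (hatHeight e'.1.1) (hatHeight e'.1.2))
    (h : lineX e y * taper (maxHeight nu) y = lineX e' y * taper (maxHeight nu) y) :
    ∃ v : PosetHat (SkewPoset nu lam),
      (hatX v, hatHeight v) = (lineX e y * taper (maxHeight nu) y, y) := by
  have hmono := strictMono_hatHeight (nu := nu) (lam := lam) |>.monotone
  have hbot : -1 ≤ y := (hmono bot_le).trans hy.1
  have htop : y ≤ maxHeight nu + 1 := hy.2.trans (hmono le_top)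
  rcases hbot.eq_or_lt with rfl | hbot
  · exact ⟨⊥, by rw [taper_neg_one, mul_zero]; rfl⟩
  rcases htop.eq_or_lt with rfl | htop
  · exact ⟨⊤, by rw [taper_add_one, mul_zero]; rfl⟩
  have hline : lineX e y = lineX e' y := mul_right_cancel₀ (taper_pos hbot htop).ne' h
  obtain ⟨c, hx, rfl⟩ :=
    (edgePoint_lineX e hy).exists_box (hline ▸ edgePoint_lineX e' hy') hne
  exact ⟨of c, by rw [taper_boxHeight, mul_one, ← hx]; rfl⟩

lemma injective_hatX_hatHeight :
    Function.Injective fun v : PosetHat (SkewPoset nu lam) => (hatX v, hatHeight v) := by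
  intro v w hvw
  obtain ⟨hx, hy⟩ := Prod.ext_iff.1 hvw
  induction v using rec_of with
  | bot => exact (eq_bot_of_apply_le strictMono_hatHeight hy.ge).symm
  | top => exact (eq_top_of_le_apply strictMono_hatHeight hy.le).symm
  | of c => induction w using rec_of with
    | bot => exact absurd hy (strictMono_hatHeight (bot_lt_of c)).ne'
    | top => exact absurd hy (strictMono_hatHeight (of_lt_top c)).ne
    | of d => rw [eq_of_boxX_eq_of_boxHeight_eq hx hy]

/-- The drawing of the Hasse diagram of a skew shape that is obtained from its rotated boxes. -/
def drawing (nu lam : YoungDiagram) : HasseDrawing (SkewPoset nu lam) where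
  pos v := (hatX v, hatHeight v)
  pos_injective := injective_hatX_hatHeight
  height_strictMono := strictMono_hatHeight
  curve e y := lineX e y * taper (maxHeight nu) y
  curve_continuousOn e := ((continuous_lineX e).mul (continuous_taper _)).continuousOn
  curve_lower e := by rw [lineX_footHeight, footX_mul_taper]
  curve_upper e := by rw [lineX_headHeight, headX_mul_taper]
  vertex_on_curve := eq_end_of_lineX_mul_taper_eq
  curve_inter _ _ _ := exists_vertex_of_lineX_mul_taper_eq

/-- The drawing of the augmented Hasse diagram of a skew shape: the two additional edges are the
tapered vertical lines at distance `maxHeight nu + 1` from the axis. -/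
def augmentedDrawing (nu lam : YoungDiagram) : AugmentedDrawing (SkewPoset nu lam) where
  toHasseDrawing := drawing nu lam
  leftCurve y := -(maxHeight nu + 1) * taper (maxHeight nu) y
  rightCurve y := (maxHeight nu + 1) * taper (maxHeight nu) y
  left_continuousOn := (continuous_const.mul (continuous_taper _)).continuousOn
  right_continuousOn := (continuous_const.mul (continuous_taper _)).continuousOn
  left_bot := mul_eq_zero_of_right _ (taper_neg_one _)
  left_top := mul_eq_zero_of_right _ (taper_add_one _)
  right_bot := mul_eq_zero_of_right _ (taper_neg_one _)
  right_top := mul_eq_zero_of_right _ (taper_add_one _)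
  left_lt _ hy e he := mul_lt_mul_of_pos_right
    (abs_lt.1 (edgePoint_lineX e he).abs_lt_maxHeight_add_one).1 (taper_pos hy.1 hy.2)
  lt_right _ hy e he := mul_lt_mul_of_pos_right
    (abs_lt.1 (edgePoint_lineX e he).abs_lt_maxHeight_add_one).2 (taper_pos hy.1 hy.2)

end SkewPoset

end

theorem mainTheorem5 (m n : ℕ) (hm : 0 < m) (hn : 0 < n) (nu lam : YoungDiagram)
    (hlam : lam ≤ nu) (hnu : ∀ c ∈ nu, c.1 + 1 < m ∧ c.2 + 1 < n) :
    StronglyPlanar (SkewPoset nu lam) ∧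
    Nonempty (AugmentedDrawing (SkewPoset nu lam)) ∧
    ∀ D : AugmentedDrawing (SkewPoset nu lam),
      (∃ (k : ℕ) (G : OrderedGraph k (HasseEdge (SkewPoset nu lam))), IsTruncatedDual D G) ∧
      ∀ (k : ℕ) (G : OrderedGraph k (HasseEdge (SkewPoset nu lam))), IsTruncatedDual D G →
        IntegrallyEquivalent (pasmPolytope nu lam m n) (flowPolytope G) := by
  refine ⟨⟨SkewPoset.drawing nu lam⟩, ⟨SkewPoset.augmentedDrawing nu lam⟩, fun D =>
    ⟨D.exists_isTruncatedDual, fun k G hG => ?_⟩⟩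
  have hfits : ∀ c ∈ nu, c.1 < m ∧ c.2 < n := fun c hc =>
    ⟨Nat.lt_of_succ_lt (hnu c hc).1, Nat.lt_of_succ_lt (hnu c hc).2⟩
  exact (integrallyEquivalent_pasmPolytope_orderPolytope hlam hfits).trans
    (integrallyEquivalent_orderPolytope_flowPolytope hG)
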